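/- A rational linear recurrence of order $\kappa$ is given by $\mathbf a=(a_0,\dots,a_{\kappa-1})\in\mathbb Q^\kappa$ with $a_0\ne 0$; for $\mathbf c\in\mathbb R^\kappa$ let $u_j(\mathbf c)=c_j$ for $j<\kappa$ and $u_{n+\kappa}(\mathbf c)=\sum_{j<\kappa}a_j\,u_{n+j}(\mathbf c)$ for $n\in\mathbb N$. Given such a recurrence and a Euclidean ball $\mathcal B\subseteq\mathbb R^\kappa$ as input, consider the following decision problems. - Robust positivity: is $u_n(\mathbf c)\ge 0$ for all $\mathbf c\in\mathcal B$ and all $n\in\mathbb N$? - Robust Skolem: is $u_n(\mathbf c)\neq 0$ for all $\mathbf c\in\mathcal B$ and all $n\in\mathbb N$? - Robust uniform ultimate positivity: is there an $N\in\mathbb N$ such that $u_n(\mathbf c)\ge0$ for all $\mathbf c\in\mathcal B$ and all $n>N$? - Robust non-uniform ultimate positivity: is there, for every $\mathbf c\in\mathcal B$, an $N\in\mathbb N$ such that $u_n(\mathbf c)\ge 0$ for all $n>N$? For $x\in\mathbb R$ let $$L(x)=\inf\Big\{c\in\mathbb R : \big|x-\tfrac nm\big|<\tfrac c{m^2}\text{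 for some } n,m\in\mathbb Z,\ m\neq0\Big\},$$ $$L_\infty(x)=\inf\Big\{c\in\mathbb R : \big|x-\tfrac nm\big|<\tfrac c{m^2}\text{ for infinitely many pairs } (n,m)\in\mathbb Z^2,\ m\neq0\Big\}.$$ Let $\mathcal T$ be the set of all $\theta\in(-\tfrac12,\tfrac12]$ such that $e^{2\pi i\theta}=p+qi$ with $p,q\in\mathbb Q\setminus\{0\}$ (so that $p^2+q^2=1$). A decision problem is called $\mathcal T$-Diophantine hard (resp. $\mathcal T$-Lagrange hard) if, using any oracle that solves it, one can compute from the rational number $\cos 2\pi\theta$ and a rational $\varepsilon>0$, for every $\theta\in\mathcal T$, a rational $\ell$ with $|\ell-L(\theta)|<\varepsilon$ (resp. $|\ell-L_\infty(\theta)|<\varepsilon$). In particular, if the problem is decidable, then such an $\ell$ is computable. **Theorem 2.** For rational linear recurrences, even restricted to order $6$: 1. for open balls, and likewise for closed balls, (a) the robust positivity problem is $\mathcal T$-Diophantine hard, (b) the robust Skolem problem is $\mathcal T$-Diophantine hard, (c) the robust uniform ultimate positivity problem is $\mathcal T$-Lagrange hard; 2. for closed balls, the robust non-uniform ultimate positivity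 problem is $\mathcal T$-Lagrange hard. These lower bounds hold even when the balls are restricted to have (positive) rational radius and a centre with real algebraic entries, where a real algebraic number $\alpha$ is given by a polynomial $p\in\mathbb Z[X]$ and rationals $a,b,r$ such that $\alpha$ is the only complex root of $p$ at distance less than $r$ from $a+ib$. -/

import Mathlib

namespace RobustLRS

/-! ### Diophantine approximation type and Lagrange constant -/

/-- The Diophantine approximation type of a real number. -/
noncomputable def diophantineType (x : ℝ) : ℝ :=
  sInf {c : ℝ | ∃ n m : ℤ, m ≠ 0 ∧ |x - (n : ℝ) / (m : ℝ)| < c / (m : ℝ) ^ 2}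

/-- The Lagrange constant of a real number. -/
noncomputable def lagrangeConstant (x : ℝ) : ℝ :=
  sInf {c : ℝ | {s : ℤ × ℤ | s.2 ≠ 0 ∧
    |x - (s.1 : ℝ) / (s.2 : ℝ)| < c / (s.2 : ℝ) ^ 2}.Infinite}

/-- Points of the complex unit circle with nonzero rational real and imaginary parts. -/
def setA : Set ℂ :=
  {z | ∃ p q : ℚ, p ≠ 0 ∧ q ≠ 0 ∧ p ^ 2 + q ^ 2 = 1 ∧ z = (p : ℂ) + (q : ℂ) * Complex.I}

/-- The angles, in turns, of the points of `setA`. -/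
def setT : Set ℝ :=
  {θ | θ ∈ Set.Ioc (-(1 / 2) : ℝ) (1 / 2) ∧
    Complex.exp (2 * (Real.pi : ℂ) * Complex.I * (θ : ℂ)) ∈ setA}

/-! ### Linear recurrences and the robust problems -/

/-- The sequence with `u (n + κ) = ∑ j, a j * u (n + j)` and `u j = c j` for `j < κ`. -/
noncomputable def lrs {κ : ℕ} (a : Fin κ → ℚ) (c : EuclideanSpace ℝ (Fin κ)) : ℕ → ℝ :=
  (LinearRecurrence.mk κ (fun j => (a j : ℝ))).mkSol c.ofLp

/-- A property of a rational linear recurrence together with a set of initial configurations. -/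
abbrev RobustProperty (κ : ℕ) : Type :=
  (Fin κ → ℚ) → Set (EuclideanSpace ℝ (Fin κ)) → Prop

def RobustSkolem (κ : ℕ) : RobustProperty κ := fun a B =>
  ∀ c ∈ B, ∀ n : ℕ, lrs a c n ≠ 0

def RobustPositivity (κ : ℕ) : RobustProperty κ := fun a B =>
  ∀ c ∈ B, ∀ n : ℕ, 0 ≤ lrs a c n

def RobustUniformUltimatePositivity (κ : ℕ) : RobustProperty κ := fun a B =>
  ∃ N : ℕ, ∀ c ∈ B, ∀ n : ℕ, N < n → 0 ≤ lrs a c n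

def RobustNonUniformUltimatePositivity (κ : ℕ) : RobustProperty κ := fun a B =>
  ∀ c ∈ B, ∃ N : ℕ, ∀ n : ℕ, N < n → 0 ≤ lrs a c n

/-! ### Finite representations of the inputs -/

/-- Codes of rational numbers: `(n, d)` stands for `n / (d + 1)`. -/
abbrev RatCode : Type := ℤ × ℕ

/-- The rational number with a given code. -/
def ratOf (r : RatCode) : ℚ := (r.1 : ℚ) / ((r.2 : ℚ) + 1)

/-- Codes `(p, a, b, r)` of algebraic numbers; `p` is a list of integer coefficients, the
constant coefficient first. -/
abbrev AlgCode : Type := List ℤ × RatCode × RatCode × RatCode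

/-- The integer polynomial with a given list of coefficients, the constant coefficient first. -/
noncomputable def polyOf (l : List ℤ) : Polynomial ℤ :=
  l.foldr (fun k P => Polynomial.C k + Polynomial.X * P) 0

/-- `(p, a, b, r)` represents the real number `x` if `x` is the only complex root of `p` at
distance less than `r` from `a + b i`. (This forces `p ≠ 0` and `0 < r`.) -/
def Represents (k : AlgCode) (x : ℝ) : Prop :=
  ∀ z : ℂ, (Polynomial.aeval z (polyOf k.1) = 0 ∧
    dist z ((ratOf k.2.1 : ℂ) + (ratOf k.2.2.1 : ℂ) * Complex.I) < (ratOf k.2.2.2 : ℝ)) ↔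
      z = (x : ℂ)

/-- Inputs of the robust problems of order `κ`: the coefficients of the recurrence, the
centre of the ball and the radius of the ball. -/
abbrev BallInput (κ : ℕ) : Type := (Fin κ → RatCode) × (Fin κ → AlgCode) × RatCode

/-- `I` is the input for the rational recurrence with coefficients `a` (where `a 0 ≠ 0`) and the
ball with real algebraic centre `c` and rational radius `ρ > 0`. -/
def Describes {κ : ℕ} [NeZero κ] (I : BallInput κ) (a : Fin κ → ℚ)
    (c : EuclideanSpace ℝ (Fin κ)) (ρ : ℚ) : Prop :=
  (∀ j, ratOf (I.1 j) = a j) ∧ (∀ j, Represents (I.2.1 j) (c j)) ∧ ratOf I.2.2 = ρ ∧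
    a 0 ≠ 0 ∧ 0 < ρ

/-! ### Decision problems and hardness -/

/-- A decision problem on codes; only the codes that satisfy `valid` are inputs. -/
structure DecisionProblem (α : Type) where
  valid : α → Prop
  yes : α → Prop

/-- `O` answers the problem correctly on all its inputs (and arbitrarily on invalid codes). -/
def Solves {α : Type} (O : α → Bool) (P : DecisionProblem α) : Prop :=
  ∀ x, P.valid x → (O x = true ↔ P.yes x)

/-- A Boolean function on codes as an oracle on natural numbers. -/
def toOracle {α : Type} [Primcodable α] (O : α → Bool) : ℕ →. ℕ :=
  ((fun n : ℕ => Encodable.encode ((Encodable.decode (α := α) n).map O) : ℕ → ℕ) : ℕ →. ℕ)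

/-- `f` approximates the real function `F` on `setT`: on input a code of the rational number
`cos (2 π θ)` and a code of a rational `ε > 0`, it outputs a code of a rational number at distance
less than `ε` from `F θ`. -/
def Approximates (F : ℝ → ℝ) (f : RatCode × RatCode → RatCode) : Prop :=
  ∀ θ ∈ setT, ∀ p e : RatCode, (ratOf p : ℝ) = Real.cos (2 * Real.pi * θ) → 0 < ratOf e →
    |(ratOf (f (p, e)) : ℝ) - F θ| < (ratOf e : ℝ)

/-- The decidability of `P` entails that `F` can be approximated on `setT`: from any oracle that
solves `P` one can compute approximations of `F`. (If `P` is solved by a computable function, the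
approximations are therefore computable.) -/
def ApproximationHard (F : ℝ → ℝ) {α : Type} [Primcodable α] (P : DecisionProblem α) : Prop :=
  ∀ O : α → Bool, Solves O P →
    ∃ f : RatCode × RatCode → RatCode, ComputableIn {toOracle O} f ∧ Approximates F f

/-- `𝒯`-Diophantine hardness. -/
def TDiophantineHard {α : Type} [Primcodable α] (P : DecisionProblem α) : Prop :=
  ApproximationHard diophantineType P

/-- `𝒯`-Lagrange hardness. -/
def TLagrangeHard {α : Type} [Primcodable α] (P : DecisionProblem α) : Prop :=
  ApproximationHard lagrangeConstant P

/-- The problem, given a rational linear recurrence of order `κ` and an open ball with real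
algebraic centre and rational radius, to determine if `Q` holds. -/
def openBallProblem {κ : ℕ} [NeZero κ] (Q : RobustProperty κ) :
    DecisionProblem (BallInput κ) where
  valid I := ∃ a c ρ, Describes I a c ρ
  yes I := ∃ a c ρ, Describes I a c ρ ∧ Q a (Metric.ball c (ρ : ℝ))

/-- The same problem for closed balls. -/
def closedBallProblem {κ : ℕ} [NeZero κ] (Q : RobustProperty κ) :
    DecisionProblem (BallInput κ) where
  valid I := ∃ a c ρ, Describes I a c ρ
  yes I := ∃ a c ρ, Describes I a c ρ ∧ Q a (Metric.closedBall c (ρ : ℝ))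

end RobustLRS

/-! Let φ = 2π|θ|, p = cos φ, q = sin φ. The recurrence with characteristic polynomial (X - 1)²(X² -
2pX + 1)² has the solutions m, m cos mφ, m sin mφ, 1, cos mφ, sin mφ, hence also u_m = m(1 - cos mφ)
- b sin mφ. With y = π(m|θ| - r), r the nearest integer, u_m = 2 sin y (m sin y - b cos y). For b >
0 this is negative exactly if y > 0 and m tan y < b; for -b the same holds with y < 0. So u_m ≥ 0
for both b and -b says, up to a small error for large m, that b ≤ π m‖mθ‖, where ‖·‖ is the distance
to the nearest integer. The largest such b, divided by π, is the infimum of m‖mθ‖ over m ≥ N if all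
m ≥ N are considered, and the Lagrange constant if almost all are. For the approximation type, the
finitely many m < N are evaluated numerically.

The robust problems speak of balls. As u_n(c) = ⟨c, v_n⟩ (`lrs_eq_inner`), a ball of centre c and
radius ρ lies on the nonnegative side for n iff ρ‖v_n‖ ≤ ⟨c, v_n⟩. For m = N + n with mφ close to a
multiple of 2π, v_n is close to m g for a fixed vector g. The ball is therefore centred at t +
(ρ/‖g‖) g, where t is the configuration of u: it touches t, so a positive answer yields u_m ≥ 0.
Conversely ⟨c, v_n⟩ - ρ‖v_n‖ = u_m - ρ(‖v_n‖ - ⟨g, v_n⟩/‖g‖), and the bracket is of second order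
(`norm_sub_inner_le`), at most a constant times m(1 - cos mφ) + 1/m. For small ρ this loss hardly
moves the threshold (`small_of_inner_centre_le`, `exists_pi_mul_le`). A search over a fine grid of b
with both signs thus finds the threshold (`quality_of_search`). `Detects` isolates what this needs
from a robust problem; its filter is `⊤` for "all n" and `atTop` for "almost all n".

The Skolem problem only gives constancy of the sign on each ball. At b = 0 the value at t is
strictly positive, which fixes the sign, and the sign is inherited along the grid because
neighbouring centres differ little compared with ρ‖v_n‖ (`detects_robustSkolem`).

Irrationality of θ comes from Niven's theorem, and Dirichlet's theorem bounds the search. The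
queries are primitive recursive: sin φ is exactly rational, the centre has entries in ℚ(√‖g‖²), 1/π
comes from Wallis' product and θ from counting half turns. -/

namespace RobustLRS

/-! ### Primitive recursive arithmetic of integers -/

section Int

theorem encode_int_natCast (n : ℕ) : Encodable.encode (n : ℤ) = 2 * n := rfl

theorem encode_int_negSucc (n : ℕ) : Encodable.encode (Int.negSucc n) = 2 * n + 1 := rfl

theorem primrec_int_toNat : Primrec Int.toNat := by
  have h : Primrec fun z : ℤ => bif (Encodable.encode z).bodd then 0 else (Encodable.encode z).div2 :=
    Primrec.cond (Primrec.nat_bodd.comp Primrec.encode) (Primrec.const 0)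
      (Primrec.nat_div2.comp Primrec.encode)
  refine h.of_eq fun z => ?_
  obtain ⟨n, rfl⟩ | ⟨n, rfl⟩ : (∃ n : ℕ, z = n) ∨ ∃ n : ℕ, z = Int.negSucc n := by
    cases z with
    | ofNat n => exact Or.inl ⟨n, rfl⟩
    | negSucc n => exact Or.inr ⟨n, rfl⟩
  · rw [encode_int_natCast]
    simp [Nat.div2_val]
  · rw [encode_int_negSucc]
    simp

theorem primrec_int_neg_toNat : Primrec fun z : ℤ => (-z).toNat := by
  have h : Primrec fun z : ℤ =>
      bif (Encodable.encode z).bodd then (Encodable.encode z).div2 + 1 else 0 :=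
    Primrec.cond (Primrec.nat_bodd.comp Primrec.encode)
      (Primrec.succ.comp (Primrec.nat_div2.comp Primrec.encode)) (Primrec.const 0)
  refine h.of_eq fun z => ?_
  obtain ⟨n, rfl⟩ | ⟨n, rfl⟩ : (∃ n : ℕ, z = n) ∨ ∃ n : ℕ, z = Int.negSucc n := by
    cases z with
    | ofNat n => exact Or.inl ⟨n, rfl⟩
    | negSucc n => exact Or.inr ⟨n, rfl⟩
  · rw [encode_int_natCast]
    simp
  · rw [encode_int_negSucc]
    simp [Nat.div2_val]

/-- With z = z⁺ - z⁻ all integer operations reduce to natural arithmetic on the two parts followed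
by this one subtraction, which is explicit in the encoding (nonnegative numbers are even codes,
negative ones odd). -/
theorem primrec_int_subNat : Primrec₂ fun a b : ℕ => (a : ℤ) - b := by
  rw [← Primrec₂.encode_iff]
  have h : Primrec fun p : ℕ × ℕ =>
      if p.2 ≤ p.1 then 2 * (p.1 - p.2) else 2 * (p.2 - p.1 - 1) + 1 := by
    have hs : Primrec fun p : ℕ × ℕ => p.1 - p.2 := Primrec.nat_sub.comp Primrec.fst Primrec.snd
    have hs' : Primrec fun p : ℕ × ℕ => p.2 - p.1 := Primrec.nat_sub.comp Primrec.snd Primrec.fst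
    exact Primrec.ite (Primrec.nat_le.comp Primrec.snd Primrec.fst)
      (Primrec.nat_double.comp hs)
      (Primrec.nat_double_succ.comp (Primrec.nat_sub.comp hs' (Primrec.const 1)))
  refine h.of_eq fun p => ?_
  obtain ⟨a, b⟩ := p
  by_cases hab : b ≤ a
  · have : ((a : ℤ) - b) = ((a - b : ℕ) : ℤ) := by omega
    simp [hab, this, encode_int_natCast, -Nat.cast_sub]
  · have : ((a : ℤ) - b) = Int.negSucc (b - a - 1) := by omega
    simp only [hab, if_false, this, encode_int_negSucc]

theorem primrec_int_natCast : Primrec fun n : ℕ => (n : ℤ) :=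
  (primrec_int_subNat.comp Primrec.id (Primrec.const 0)).of_eq fun n => by simp

theorem primrec_int_add : Primrec₂ ((· + ·) : ℤ → ℤ → ℤ) := by
  have p1 := primrec_int_toNat.comp (Primrec.fst (α := ℤ) (β := ℤ))
  have p2 := primrec_int_toNat.comp (Primrec.snd (α := ℤ) (β := ℤ))
  have n1 := primrec_int_neg_toNat.comp (Primrec.fst (α := ℤ) (β := ℤ))
  have n2 := primrec_int_neg_toNat.comp (Primrec.snd (α := ℤ) (β := ℤ))
  refine (primrec_int_subNat.comp (Primrec.nat_add.comp p1 p2)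
    (Primrec.nat_add.comp n1 n2)).of_eq fun p => ?_
  push_cast
  omega

theorem primrec_int_neg : Primrec fun z : ℤ => -z :=
  (primrec_int_subNat.comp primrec_int_neg_toNat primrec_int_toNat).of_eq fun z => by omega

theorem primrec_int_sub : Primrec₂ ((· - ·) : ℤ → ℤ → ℤ) :=
  (primrec_int_add.comp Primrec.fst (primrec_int_neg.comp Primrec.snd)).of_eq fun p =>
    (sub_eq_add_neg p.1 p.2).symm

theorem primrec_int_mul : Primrec₂ ((· * ·) : ℤ → ℤ → ℤ) := by
  have p1 := primrec_int_toNat.comp (Primrec.fst (α := ℤ) (β := ℤ))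
  have p2 := primrec_int_toNat.comp (Primrec.snd (α := ℤ) (β := ℤ))
  have n1 := primrec_int_neg_toNat.comp (Primrec.fst (α := ℤ) (β := ℤ))
  have n2 := primrec_int_neg_toNat.comp (Primrec.snd (α := ℤ) (β := ℤ))
  refine (primrec_int_subNat.comp
    (Primrec.nat_add.comp (Primrec.nat_mul.comp p1 p2) (Primrec.nat_mul.comp n1 n2))
    (Primrec.nat_add.comp (Primrec.nat_mul.comp p1 n2) (Primrec.nat_mul.comp n1 p2))).of_eq
      fun p => ?_
  have h1 : ((p.1.toNat : ℤ)) - ((-p.1).toNat : ℤ) = p.1 := by omega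
  have h2 : ((p.2.toNat : ℤ)) - ((-p.2).toNat : ℤ) = p.2 := by omega
  push_cast
  linear_combination ((p.2.toNat : ℤ) - ((-p.2).toNat : ℤ)) * h1 + p.1 * h2

theorem primrec_int_pos : PrimrecPred fun z : ℤ => 0 < z :=
  (Primrec.nat_lt.comp (Primrec.const 0) primrec_int_toNat).of_eq fun z => by omega

theorem primrec_int_eq_zero : PrimrecPred fun z : ℤ => z = 0 :=
  Primrec.eq.comp Primrec.id (Primrec.const 0)

end Int

/-! ### Primitive recursive functions with rational values -/

theorem ratOf_mk (n : ℤ) (d : ℕ) : ratOf (n, d) = (n : ℚ) / ((d : ℚ) + 1) := rfl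

/-- `F` is computed by a primitive recursive function on codes of rational numbers. -/
def PrimrecRat {α : Type} [Primcodable α] (F : α → ℚ) : Prop :=
  ∃ f : α → RatCode, Primrec f ∧ ∀ a, ratOf (f a) = F a

namespace PrimrecRat

variable {α β : Type} [Primcodable α] [Primcodable β] {F G : α → ℚ}

theorem of_eq (hF : PrimrecRat F) (h : ∀ a, F a = G a) : PrimrecRat G :=
  (funext h : F = G) ▸ hF

theorem comp {F : β → ℚ} (hF : PrimrecRat F) {f : α → β} (hf : Primrec f) :
    PrimrecRat fun a => F (f a) := by
  obtain ⟨c, hc, h⟩ := hF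
  exact ⟨fun a => c (f a), hc.comp hf, fun a => h _⟩

theorem intCast {f : α → ℤ} (hf : Primrec f) : PrimrecRat fun a => (f a : ℚ) :=
  ⟨fun a => (f a, 0), Primrec.pair hf (Primrec.const 0), fun a => by simp [ratOf_mk]⟩

theorem natCast {f : α → ℕ} (hf : Primrec f) : PrimrecRat fun a => (f a : ℚ) :=
  (intCast (primrec_int_natCast.comp hf)).of_eq fun a => by simp

theorem const (q : ℚ) : PrimrecRat fun _ : α => q := by
  -- Codes store the denominator minus one.
  refine ⟨fun _ => (q.num, q.den - 1), Primrec.const _, fun _ => ?_⟩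
  have h : ((q.den - 1 : ℕ) : ℚ) + 1 = q.den := by
    have := q.pos
    exact_mod_cast (by omega : q.den - 1 + 1 = q.den)
  rw [ratOf_mk, h, Rat.num_div_den]

theorem add (hF : PrimrecRat F) (hG : PrimrecRat G) : PrimrecRat fun a => F a + G a := by
  obtain ⟨f, hf, hfF⟩ := hF
  obtain ⟨g, hg, hgG⟩ := hG
  have f1 := Primrec.fst.comp hf
  have f2 := Primrec.succ.comp (Primrec.snd.comp hf)
  have g1 := Primrec.fst.comp hg
  have g2 := Primrec.succ.comp (Primrec.snd.comp hg)
  refine ⟨fun a => ((f a).1 * (((g a).2 + 1 : ℕ) : ℤ) + (g a).1 * (((f a).2 + 1 : ℕ) : ℤ),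
      ((f a).2 + 1) * ((g a).2 + 1) - 1),
    Primrec.pair (primrec_int_add.comp
        (primrec_int_mul.comp f1 (primrec_int_natCast.comp g2))
        (primrec_int_mul.comp g1 (primrec_int_natCast.comp f2)))
      (Primrec.pred.comp (Primrec.nat_mul.comp f2 g2)), fun a => ?_⟩
  have h : ((((f a).2 + 1) * ((g a).2 + 1) - 1 : ℕ) : ℚ) + 1
      = (((f a).2 : ℚ) + 1) * (((g a).2 : ℚ) + 1) := by
    have : 0 < ((f a).2 + 1) * ((g a).2 + 1) := by positivity
    exact_mod_cast Nat.sub_add_cancel this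
  beta_reduce
  rw [ratOf_mk, h, ← hfF, ← hgG]
  simp only [RobustLRS.ratOf]
  push_cast
  field_simp

theorem neg (hF : PrimrecRat F) : PrimrecRat fun a => -F a := by
  obtain ⟨f, hf, hfF⟩ := hF
  refine ⟨fun a => (-(f a).1, (f a).2), Primrec.pair (primrec_int_neg.comp (Primrec.fst.comp hf))
    (Primrec.snd.comp hf), fun a => ?_⟩
  beta_reduce
  rw [← hfF]
  simp only [RobustLRS.ratOf]
  push_cast
  ring

theorem sub (hF : PrimrecRat F) (hG : PrimrecRat G) : PrimrecRat fun a => F a - G a :=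
  (hF.add hG.neg).of_eq fun _ => (sub_eq_add_neg _ _).symm

theorem mul (hF : PrimrecRat F) (hG : PrimrecRat G) : PrimrecRat fun a => F a * G a := by
  obtain ⟨f, hf, hfF⟩ := hF
  obtain ⟨g, hg, hgG⟩ := hG
  have f1 := Primrec.fst.comp hf
  have f2 := Primrec.succ.comp (Primrec.snd.comp hf)
  have g1 := Primrec.fst.comp hg
  have g2 := Primrec.succ.comp (Primrec.snd.comp hg)
  refine ⟨fun a => ((f a).1 * (g a).1, ((f a).2 + 1) * ((g a).2 + 1) - 1),
    Primrec.pair (primrec_int_mul.comp f1 g1)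
      (Primrec.pred.comp (Primrec.nat_mul.comp f2 g2)), fun a => ?_⟩
  have h : ((((f a).2 + 1) * ((g a).2 + 1) - 1 : ℕ) : ℚ) + 1
      = (((f a).2 : ℚ) + 1) * (((g a).2 : ℚ) + 1) := by
    have : 0 < ((f a).2 + 1) * ((g a).2 + 1) := by positivity
    exact_mod_cast Nat.sub_add_cancel this
  beta_reduce
  rw [ratOf_mk, h, ← hfF, ← hgG]
  simp only [RobustLRS.ratOf]
  push_cast
  field_simp

/-- The code of the inverse of the rational number with a given code. -/
def invCode (r : RatCode) : RatCode :=
  ((r.2 + 1 : ℕ) * ((if 0 < r.1 then 1 else 0) - (if 0 < -r.1 then 1 else 0) : ℤ),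
    r.1.toNat + (-r.1).toNat - 1)

/-- The sign of the numerator is a difference of two indicators and its absolute value a sum of two
truncations. At 0 the sign vanishes, which matches the convention 0⁻¹ = 0. -/
theorem ratOf_invCode (r : RatCode) : RobustLRS.ratOf (invCode r) = (RobustLRS.ratOf r)⁻¹ := by
  obtain ⟨n, d⟩ := r
  simp only [invCode, ratOf_mk]
  rcases lt_trichotomy n 0 with h | rfl | h
  · have h1 : ¬ (0 < n) := by omega
    have h2 : 0 < -n := by omega
    obtain ⟨l, rfl⟩ : ∃ l : ℕ, n = -(l + 1) := ⟨(-n).toNat - 1, by omega⟩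
    have h3 : (-((l : ℤ) + 1)).toNat + (-(-((l : ℤ) + 1))).toNat - 1 = l := by omega
    rw [if_neg h1, if_pos h2, h3]
    push_cast
    have : (l : ℚ) + 1 ≠ 0 := by positivity
    field_simp
  · simp
  · have h1 : ¬ (0 < -n) := by omega
    obtain ⟨l, rfl⟩ : ∃ l : ℕ, n = l + 1 := ⟨n.toNat - 1, by omega⟩
    have h3 : ((l : ℤ) + 1).toNat + (-((l : ℤ) + 1)).toNat - 1 = l := by omega
    rw [if_neg h1, if_pos h, h3]
    push_cast
    have : (l : ℚ) + 1 ≠ 0 := by positivity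
    field_simp

theorem primrec_invCode : Primrec invCode := by
  have h1 : Primrec fun r : RatCode => (if 0 < r.1 then 1 else 0 : ℤ) :=
    Primrec.ite (primrec_int_pos.comp Primrec.fst) (Primrec.const 1) (Primrec.const 0)
  have h2 : Primrec fun r : RatCode => (if 0 < -r.1 then 1 else 0 : ℤ) :=
    Primrec.ite (primrec_int_pos.comp (primrec_int_neg.comp Primrec.fst)) (Primrec.const 1)
      (Primrec.const 0)
  exact Primrec.pair
    (primrec_int_mul.comp (primrec_int_natCast.comp (Primrec.succ.comp Primrec.snd))
      (primrec_int_sub.comp h1 h2))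
    (Primrec.pred.comp (Primrec.nat_add.comp (primrec_int_toNat.comp Primrec.fst)
      (primrec_int_neg_toNat.comp Primrec.fst)))

theorem inv (hF : PrimrecRat F) : PrimrecRat fun a => (F a)⁻¹ := by
  obtain ⟨f, hf, hfF⟩ := hF
  exact ⟨fun a => invCode (f a), primrec_invCode.comp hf, fun a => by rw [ratOf_invCode, hfF]⟩

theorem div (hF : PrimrecRat F) (hG : PrimrecRat G) : PrimrecRat fun a => F a / G a :=
  (hF.mul hG.inv).of_eq fun _ => (div_eq_mul_inv _ _).symm

theorem ite {p : α → Prop} [DecidablePred p] (hp : PrimrecPred p) (hF : PrimrecRat F)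
    (hG : PrimrecRat G) : PrimrecRat fun a => if p a then F a else G a := by
  obtain ⟨f, hf, hfF⟩ := hF
  obtain ⟨g, hg, hgG⟩ := hG
  refine ⟨fun a => if p a then f a else g a, Primrec.ite hp hf hg, fun a => ?_⟩
  beta_reduce
  split_ifs
  exacts [hfF a, hgG a]

theorem primrecPred_pos (hF : PrimrecRat F) : PrimrecPred fun a => 0 < F a := by
  obtain ⟨f, hf, hfF⟩ := hF
  refine (primrec_int_pos.comp (Primrec.fst.comp hf)).of_eq fun a => ?_
  rw [← hfF]
  simp only [RobustLRS.ratOf]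
  rw [div_pos_iff_of_pos_right (by positivity)]
  exact_mod_cast Iff.rfl

theorem abs (hF : PrimrecRat F) : PrimrecRat fun a => |F a| :=
  (ite hF.primrecPred_pos hF hF.neg).of_eq fun a => by
    split_ifs with h
    · rw [abs_of_pos h]
    · rw [abs_of_nonpos (not_lt.1 h)]

theorem min (hF : PrimrecRat F) (hG : PrimrecRat G) : PrimrecRat fun a => min (F a) (G a) :=
  (ite (hG.sub hF).primrecPred_pos hF hG).of_eq fun a => by
    split_ifs with h
    · rw [min_eq_left (by linarith)]
    · rw [min_eq_right (by linarith)]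

theorem sum {ι : Type*} (s : Finset ι) {H : ι → α → ℚ} (hH : ∀ i ∈ s, PrimrecRat (H i)) :
    PrimrecRat fun a => ∑ i ∈ s, H i a := by
  classical
  induction s using Finset.induction_on with
  | empty => exact (const 0).of_eq fun a => by simp
  | insert i s hi ih =>
    exact ((hH i (Finset.mem_insert_self i s)).add
      (ih fun l hl => hH l (Finset.mem_insert_of_mem hl))).of_eq fun a =>
        (Finset.sum_insert hi (f := fun l => H l a)).symm

theorem prod {ι : Type*} (s : Finset ι) {H : ι → α → ℚ} (hH : ∀ i ∈ s, PrimrecRat (H i)) :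
    PrimrecRat fun a => ∏ i ∈ s, H i a := by
  classical
  induction s using Finset.induction_on with
  | empty => exact (const 1).of_eq fun a => by simp
  | insert i s hi ih =>
    exact ((hH i (Finset.mem_insert_self i s)).mul
      (ih fun l hl => hH l (Finset.mem_insert_of_mem hl))).of_eq fun a =>
        (Finset.prod_insert hi (f := fun l => H l a)).symm

/-- The size of the matrix is fixed, so the Leibniz formula is a fixed finite expression in the
entries. -/
theorem det {ι : Type*} [Fintype ι] [DecidableEq ι] {A : α → Matrix ι ι ℚ}
    (hA : ∀ i l, PrimrecRat fun a => A a i l) : PrimrecRat fun a => (A a).det := by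
  refine (sum Finset.univ (H := fun (σ : Equiv.Perm ι) a =>
    ((Equiv.Perm.sign σ : ℤ) : ℚ) * ∏ i, A a (σ i) i) fun σ _ =>
      (const _).mul (prod _ fun i _ => hA _ _)).of_eq fun a => ?_
  rw [Matrix.det_apply']

/-- Cramer's rule: the entries of the adjugate are determinants with one row replaced by a unit
vector. Singular matrices do no harm, since both sides use the inverse 0 of 0. -/
theorem matrix_inv {ι : Type*} [Fintype ι] [DecidableEq ι] {A : α → Matrix ι ι ℚ}
    (hA : ∀ i l, PrimrecRat fun a => A a i l) (i l : ι) : PrimrecRat fun a => (A a)⁻¹ i l := by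
  have h : PrimrecRat fun a => ((A a).updateRow l (Pi.single i 1)).det := by
    refine det fun x y => ?_
    by_cases hx : x = l
    · subst hx
      exact (const ((Pi.single i 1 : ι → ℚ) y)).of_eq fun a => by simp
    · exact (hA x y).of_eq fun a => by rw [Matrix.updateRow_ne hx]
  refine ((det hA).inv.mul h).of_eq fun a => ?_
  rw [Matrix.inv_def, Matrix.smul_apply, Matrix.adjugate_apply, Ring.inverse_eq_inv, smul_eq_mul]

/-- A natural number above a rational number can be found primitive recursively. -/
theorem exists_nat_ge (hF : PrimrecRat F) : ∃ f : α → ℕ, Primrec f ∧ ∀ a, F a ≤ f a := by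
  obtain ⟨f, hf, hfF⟩ := hF
  refine ⟨fun a => (f a).1.toNat, primrec_int_toNat.comp (Primrec.fst.comp hf), fun a => ?_⟩
  rw [← hfF]
  simp only [RobustLRS.ratOf]
  rw [div_le_iff₀ (by positivity)]
  have h1 : (((f a).1 : ℤ) : ℚ) ≤ (((f a).1.toNat : ℕ) : ℚ) := by
    exact_mod_cast Int.self_le_toNat _
  have h2 : (0 : ℚ) ≤ (((f a).1.toNat : ℕ) : ℚ) * (f a).2 := by positivity
  linarith

end PrimrecRat

/-! ### Codes of quadratic irrationals -/

theorem aeval_polyOf_quadratic (x y w : ℤ) (z : ℂ) :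
    Polynomial.aeval z (polyOf [x, y, w]) = x + y * z + w * z ^ 2 := by
  simp [polyOf]
  ring

/-- Numbers of the form `α + β √δ` have primitive recursive codes. -/
theorem exists_algCode {X : Type} [Primcodable X] {α β δ : X → ℚ} (hα : PrimrecRat α)
    (hβ : PrimrecRat β) (hδ : PrimrecRat δ) :
    ∃ f : X → AlgCode, Primrec f ∧ ∀ x, 0 < δ x →
      Represents (f x) ((α x : ℝ) + (β x : ℝ) * √(δ x : ℝ)) := by
  -- The polynomial is z² - 2αz + (α² - β²δ) with denominators cleared; its roots are α ± β√δ.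
  obtain ⟨u, hu, hu'⟩ := (hα.mul hα).sub ((hβ.mul hβ).mul hδ)
  obtain ⟨v, hv, hv'⟩ := ((PrimrecRat.const (-2)).mul hα)
  -- No approximation of √δ is needed to separate the roots. From the point α + β(δ + 1) they have
  -- distances |β|(δ + 1 - √δ) and |β|(δ + 1 + √δ), on either side of the radius |β|(δ + 1). If β =
  -- 0 the roots coincide and any positive radius will do.
  obtain ⟨ce, hce, hce'⟩ := hα.add (hβ.mul (hδ.add (PrimrecRat.const 1)))
  have hrad : PrimrecRat fun x => if 0 < |β x| then |β x| * (δ x + 1) else 1 :=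
    PrimrecRat.ite hβ.abs.primrecPred_pos (hβ.abs.mul (hδ.add (PrimrecRat.const 1)))
      (PrimrecRat.const 1)
  obtain ⟨ra, hra, hra'⟩ := hrad
  have u1 := Primrec.fst.comp hu
  have u2 := primrec_int_natCast.comp (Primrec.succ.comp (Primrec.snd.comp hu))
  have v1 := Primrec.fst.comp hv
  have v2 := primrec_int_natCast.comp (Primrec.succ.comp (Primrec.snd.comp hv))
  refine ⟨fun x => ([(u x).1 * ((v x).2 + 1 : ℕ), (v x).1 * ((u x).2 + 1 : ℕ),
      ((u x).2 + 1 : ℕ) * ((v x).2 + 1 : ℕ)], ce x, (0, 0), ra x), ?_, fun x hx => ?_⟩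
  · exact Primrec.pair (Primrec.list_cons.comp (primrec_int_mul.comp u1 v2)
      (Primrec.list_cons.comp (primrec_int_mul.comp v1 u2)
        (Primrec.list_cons.comp (primrec_int_mul.comp u2 v2) (Primrec.const []))))
      (Primrec.pair hce (Primrec.pair (Primrec.const _) hra))
  · intro z
    have hs : (√(δ x : ℝ)) ^ 2 = (δ x : ℝ) := Real.sq_sqrt (by exact_mod_cast hx.le)
    have hs0 : 0 < √(δ x : ℝ) := Real.sqrt_pos.2 (by exact_mod_cast hx)
    set s := √(δ x : ℝ) with hsdef
    have key : Polynomial.aeval z (polyOf [(u x).1 * ((v x).2 + 1 : ℕ),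
        (v x).1 * ((u x).2 + 1 : ℕ), ((u x).2 + 1 : ℕ) * ((v x).2 + 1 : ℕ)]) = 0 ↔
        z = ((α x + β x * s : ℝ) : ℂ) ∨ z = ((α x - β x * s : ℝ) : ℂ) := by
      rw [aeval_polyOf_quadratic]
      have hU : (((u x).1 : ℤ) : ℂ) = ((α x * α x - β x * β x * δ x : ℚ) : ℂ) * ((u x).2 + 1) := by
        have h0 : ((u x).2 : ℚ) + 1 ≠ 0 := by positivity
        have : (((u x).1 : ℤ) : ℚ) = (α x * α x - β x * β x * δ x) * ((u x).2 + 1) := by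
          have h1 := hu' x
          beta_reduce at h1
          rw [← h1, ratOf]
          field_simp
        exact_mod_cast congrArg (fun q : ℚ => (q : ℂ)) this
      have hV : (((v x).1 : ℤ) : ℂ) = ((-2 * α x : ℚ) : ℂ) * ((v x).2 + 1) := by
        have h0 : ((v x).2 : ℚ) + 1 ≠ 0 := by positivity
        have : (((v x).1 : ℤ) : ℚ) = (-2 * α x) * ((v x).2 + 1) := by
          have h1 := hv' x
          beta_reduce at h1
          rw [← h1, ratOf]
          field_simp
        exact_mod_cast congrArg (fun q : ℚ => (q : ℂ)) this
      have hsC : (s : ℂ) ^ 2 = (δ x : ℂ) := by exact_mod_cast congrArg (fun q : ℝ => (q : ℂ)) hs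
      have hfac : (((u x).1 * ((v x).2 + 1 : ℕ) : ℤ) : ℂ) + (((v x).1 * ((u x).2 + 1 : ℕ) : ℤ) : ℂ) * z
          + ((((u x).2 + 1 : ℕ) * ((v x).2 + 1 : ℕ) : ℤ) : ℂ) * z ^ 2
          = (((u x).2 : ℂ) + 1) * (((v x).2 : ℂ) + 1) *
            ((z - ((α x + β x * s : ℝ) : ℂ)) * (z - ((α x - β x * s : ℝ) : ℂ))) := by
        push_cast at hU hV ⊢
        rw [hU, hV]
        linear_combination (((u x).2 : ℂ) + 1) * (((v x).2 : ℂ) + 1) * (β x : ℂ) ^ 2 * hsC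
      rw [hfac]
      have h1 : (((u x).2 : ℂ) + 1) ≠ 0 := by exact_mod_cast Nat.succ_ne_zero (u x).2
      have h2 : (((v x).2 : ℂ) + 1) ≠ 0 := by exact_mod_cast Nat.succ_ne_zero (v x).2
      simp only [mul_eq_zero, h1, h2, false_or, sub_eq_zero]
    have hcen : ((ratOf (ce x) : ℂ) + (ratOf ((0, 0) : RatCode) : ℂ) * Complex.I)
        = ((α x + β x * (δ x + 1) : ℝ) : ℂ) := by
      rw [hce', ratOf_mk]
      push_cast
      ring
    simp only [key, hcen, hra']
    have hlt : s < (δ x : ℝ) + 1 := by nlinarith [sq_nonneg (s - 1)]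
    by_cases hb : β x = 0
    · simp [hb]
      rintro rfl
      simp
    · have hb' : 0 < |β x| := abs_pos.2 hb
      rw [if_pos hb']
      have hbR : 0 < |(β x : ℝ)| := by exact_mod_cast hb'
      constructor
      · rintro ⟨rfl | rfl, hd⟩
        · rfl
        · exfalso
          rw [Complex.dist_eq, ← Complex.ofReal_sub, Complex.norm_real, Real.norm_eq_abs] at hd
          have : (α x : ℝ) - β x * s - (α x + β x * (δ x + 1)) = -(β x * (s + (δ x + 1))) := by ring
          rw [this, abs_neg, abs_mul, abs_of_pos (by linarith : 0 < s + ((δ x : ℝ) + 1))] at hd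
          push_cast at hd
          have := lt_of_mul_lt_mul_left hd hbR.le
          linarith
      · rintro rfl
        refine ⟨Or.inl rfl, ?_⟩
        rw [Complex.dist_eq, ← Complex.ofReal_sub, Complex.norm_real, Real.norm_eq_abs]
        have : (α x : ℝ) + β x * s - (α x + β x * (δ x + 1)) = -(β x * ((δ x + 1) - s)) := by ring
        rw [this, abs_neg, abs_mul, abs_of_pos (by linarith : 0 < ((δ x : ℝ) + 1) - s)]
        push_cast
        exact mul_lt_mul_of_pos_left (by linarith) hbR

/-! ### Searching with an oracle -/

/-- The least `j` for which `O (q (x, j))` fails, or `bd x` if this is smaller, can be found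
with the oracle `O`. -/
theorem exists_computableIn_search {α X Y : Type} [Primcodable α] [Primcodable X] [Primcodable Y]
    {q : X × ℕ → α} (hq : Primrec q) {bd : X → ℕ} (hbd : Primrec bd) {post : X × ℕ → Y}
    (hpost : Primrec post) (O : α → Bool) :
    ∃ f : X → Y, ComputableIn {toOracle O} f ∧ ∀ x, ∃ j, f x = post (x, j) ∧
      (∀ i < j, i < bd x ∧ O (q (x, i)) = true) ∧ ¬ (j < bd x ∧ O (q (x, j)) = true) := by
  classical
  let T : X → ℕ → Prop := fun x j => ¬ (j < bd x ∧ O (q (x, j)) = true)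
  have hT : ∀ x, ∃ j, T x j := fun x => ⟨bd x, fun h => lt_irrefl _ h.1⟩
  refine ⟨fun x => post (x, Nat.find (hT x)), ?_, fun x => ⟨Nat.find (hT x), rfl, fun i hi => ?_,
    Nat.find_spec (hT x)⟩⟩
  swap
  · have := Nat.find_min (hT x) hi
    exact not_not.1 this
  -- the query, as a function on numbers
  have hA : Nat.Primrec fun n => Encodable.encode ((Encodable.decode (α := X × ℕ) n).map q) := by
    have : Primrec fun n : ℕ => (Encodable.decode (α := X × ℕ) n).map q :=
      Primrec.option_map Primrec.decode (hq.comp Primrec.snd).to₂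
    exact Primrec.nat_iff.1 (Primrec.encode_iff.2 this)
  -- The code of `some a` is one more than that of `a`, so the predecessor removes the option.
  have hA' : Nat.Primrec fun n => (Encodable.encode ((Encodable.decode (α := X × ℕ) n).map q)).pred :=
    Primrec.nat_iff.1 (Primrec.pred.comp (Primrec.nat_iff.2 hA))
  -- the answer is `encode (some b)`
  let B : ℕ → ℕ := fun n => match Encodable.decode (α := X × ℕ) n.unpair.1 with
    | none => 0
    | some p => if p.2 < bd p.1 ∧ n.unpair.2 = 2 then 1 else 0
  -- In `B` the number 2 is the code of `some true`. The value 1 means that the search goes on,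
  -- because `rfind` looks for a zero.
  have hB : Nat.Primrec B := by
    have h1 : Primrec fun n : ℕ => Encodable.decode (α := X × ℕ) n.unpair.1 :=
      Primrec.decode.comp (Primrec.fst.comp Primrec.unpair)
    have hp : PrimrecPred fun a : ℕ × (X × ℕ) => a.2.2 < bd a.2.1 ∧ a.1.unpair.2 = 2 :=
      PrimrecPred.and
        (Primrec.nat_lt.comp (Primrec.snd.comp Primrec.snd)
          (hbd.comp (Primrec.fst.comp Primrec.snd)))
        (Primrec.eq.comp (Primrec.snd.comp (Primrec.unpair.comp Primrec.fst)) (Primrec.const 2))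
    have h2 : Primrec fun n : ℕ => Option.casesOn (motive := fun _ => ℕ)
        (Encodable.decode (α := X × ℕ) n.unpair.1) 0
        (fun p => if p.2 < bd p.1 ∧ n.unpair.2 = 2 then 1 else 0) :=
      Primrec.option_casesOn h1 (Primrec.const 0)
        (Primrec.ite hp (Primrec.const 1) (Primrec.const 0)).to₂
    refine Primrec.nat_iff.1 (h2.of_eq fun n => ?_)
    simp only [B]
    cases Encodable.decode (α := X × ℕ) n.unpair.1 <;> rfl
  have horacle : Nat.RecursiveIn {toOracle O} (toOracle O) := .oracle _ rfl
  have hans := Nat.RecursiveIn.comp horacle (hA'.recursiveIn (O := {toOracle O}))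
  have hid : Nat.RecursiveIn {toOracle O} fun n : ℕ => ((id n : ℕ) : Part ℕ) :=
    Nat.Primrec.recursiveIn Nat.Primrec.id
  have htest := Nat.RecursiveIn.comp (hB.recursiveIn (O := {toOracle O})) (.pair hid hans)
  have hfind := Nat.RecursiveIn.rfind htest
  let P : ℕ → ℕ := fun n => match Encodable.decode (α := X × ℕ) n with
    | none => 0
    | some p => Encodable.encode (post p)
  have hP : Nat.Primrec P := by
    have h2 : Primrec fun n : ℕ => Option.casesOn (motive := fun _ => ℕ)
        (Encodable.decode (α := X × ℕ) n) 0 (fun p => Encodable.encode (post p)) :=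
      Primrec.option_casesOn Primrec.decode (Primrec.const 0)
        (Primrec.encode.comp (hpost.comp Primrec.snd)).to₂
    refine Primrec.nat_iff.1 (h2.of_eq fun n => ?_)
    simp only [P]
    cases Encodable.decode (α := X × ℕ) n <;> rfl
  have hall := Nat.RecursiveIn.comp (hP.recursiveIn (O := {toOracle O})) (.pair hid hfind)
  -- restriction to valid codes
  have hdec : Nat.RecursiveIn {toOracle O} fun n : ℕ =>
      (Encodable.decode (α := X) n : Part X).map Encodable.encode := by
    have : Partrec fun n : ℕ => (Encodable.decode (α := X) n : Part X) :=
      Computable.ofOption Computable.decode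
    refine Nat.RecursiveIn.of_eq (Partrec.recursiveIn (O := {toOracle O}) this) fun n => ?_
    simp
  refine Nat.RecursiveIn.of_eq (Nat.RecursiveIn.comp hall hdec) fun n => ?_
  rcases hd : Encodable.decode (α := X) n with _ | x
  · simp
  · have hcell : ∀ j, B (Nat.pair (Nat.pair (Encodable.encode x) j)
        (Encodable.encode (some (O (q (x, j))) : Option Bool)))
        = if j < bd x ∧ O (q (x, j)) = true then 1 else 0 := by
      intro j
      have h1 : Encodable.decode (α := X × ℕ) (Nat.pair (Encodable.encode x) j) = some (x, j) := by
        rw [show Nat.pair (Encodable.encode x) j = Encodable.encode (x, j) from rfl,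
          Encodable.encodek]
      simp only [B, Nat.unpair_pair, h1]
      rcases O (q (x, j)) <;> simp
    have horc : ∀ j, toOracle O (Encodable.encode ((Encodable.decode (α := X × ℕ)
        (Nat.pair (Encodable.encode x) j)).map q)).pred
        = Part.some (Encodable.encode (some (O (q (x, j))) : Option Bool)) := by
      intro j
      have h1 : Encodable.decode (α := X × ℕ) (Nat.pair (Encodable.encode x) j) = some (x, j) := by
        rw [show Nat.pair (Encodable.encode x) j = Encodable.encode (x, j) from rfl,
          Encodable.encodek]
      rw [h1]
      simp [toOracle, Encodable.encodek]
    have hpost' : P (Nat.pair (Encodable.encode x) (Nat.find (hT x)))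
        = Encodable.encode (post (x, Nat.find (hT x))) := by
      have h1 : Encodable.decode (α := X × ℕ) (Nat.pair (Encodable.encode x) (Nat.find (hT x)))
          = some (x, Nat.find (hT x)) := by
        rw [show Nat.pair (Encodable.encode x) (Nat.find (hT x))
          = Encodable.encode (x, Nat.find (hT x)) from rfl, Encodable.encodek]
      simp only [P, h1]
    have hr : Nat.find (hT x) ∈ Nat.rfind fun j => Part.some
        (decide ((if j < bd x ∧ O (q (x, j)) = true then 1 else 0) = 0)) := by
      refine Nat.mem_rfind.2 ⟨?_, fun {i} hi => ?_⟩
      · have := Nat.find_spec (hT x)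
        simp only [T] at this
        simp only [if_neg this]
        simp
      · have := Nat.find_min (hT x) hi
        simp only [T, not_not] at this
        simp only [if_pos this]
        simp
    have hr' := Part.eq_some_iff.2 hr
    simp only [Part.coe_some, Part.map_some, Part.bind_eq_bind, Part.bind_some, Part.bind_some_eq_map, Seq.seq, Part.map_eq_map, id]
    have hb : ∀ a : ℕ, (Part.some a >>= toOracle O) = toOracle O a := fun a => Part.bind_some a _
    simp only [hb, horc, Part.map_some, hcell, hr', hpost']

end RobustLRS


namespace RobustLRS

/-! ### A family of recurrences of order six -/

/-- Real and imaginary part of `(p + q i) ^ m`. -/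
def rot (p q : ℚ) : ℕ → ℚ × ℚ
  | 0 => (1, 0)
  | m + 1 => (p * (rot p q m).1 - q * (rot p q m).2, q * (rot p q m).1 + p * (rot p q m).2)

/-- The coefficients of the recurrence with characteristic polynomial
`(X - 1) ^ 2 * (X ^ 2 - 2 * p * X + 1) ^ 2`. -/
def coeffs (p : ℚ) : Fin 6 → ℚ :=
  ![-1, 4 * p + 2, -(4 * p ^ 2 + 8 * p + 3), 8 * p ^ 2 + 8 * p + 4, -(4 * p ^ 2 + 8 * p + 3),
    4 * p + 2]

/-- The values at `m` of the basic solutions of the recurrence. -/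
def basicSol (p q : ℚ) (m : ℕ) : Fin 6 → ℚ :=
  ![(m : ℚ), m * (rot p q m).1, m * (rot p q m).2, 1, (rot p q m).1, (rot p q m).2]

/-- Six consecutive values of the basic solutions. -/
def casorati (p q : ℚ) (N : ℕ) : Matrix (Fin 6) (Fin 6) ℚ :=
  Matrix.of fun l j => basicSol p q (N + j) l

/-! ### Solutions of the recurrence and their Casorati determinant -/

section Rational

variable {p q : ℚ}

theorem rot_add_two (h : p ^ 2 + q ^ 2 = 1) (m : ℕ) :
    (rot p q (m + 2)).1 = 2 * p * (rot p q (m + 1)).1 - (rot p q m).1 ∧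
      (rot p q (m + 2)).2 = 2 * p * (rot p q (m + 1)).2 - (rot p q m).2 := by
  simp only [rot]
  constructor
  · linear_combination (-(rot p q m).1) * h
  · linear_combination (-(rot p q m).2) * h

theorem rot_sq_add_sq (h : p ^ 2 + q ^ 2 = 1) (m : ℕ) :
    (rot p q m).1 ^ 2 + (rot p q m).2 ^ 2 = 1 := by
  induction m with
  | zero => simp [rot]
  | succ m ih =>
    simp only [rot]
    linear_combination (p ^ 2 + q ^ 2) * ih + h

theorem rot_complex (m : ℕ) :
    (((rot p q m).1 : ℂ) + ((rot p q m).2 : ℂ) * Complex.I = ((p : ℂ) + q * Complex.I) ^ m) ∧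
    (((rot p q m).1 : ℂ) - ((rot p q m).2 : ℂ) * Complex.I = ((p : ℂ) - q * Complex.I) ^ m) := by
  induction m with
  | zero => simp [rot]
  | succ m ih =>
    rw [pow_succ, pow_succ, ← ih.1, ← ih.2]
    simp only [rot]
    push_cast
    constructor <;> linear_combination
      (-(q : ℂ) * ((rot p q m).2 : ℂ)) * Complex.I_sq

theorem basicSol_add_six (h : p ^ 2 + q ^ 2 = 1) (m : ℕ) (l : Fin 6) :
    basicSol p q (m + 6) l = ∑ j : Fin 6, coeffs p j * basicSol p q (m + j) l := by
  obtain ⟨a2, b2⟩ := rot_add_two h m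
  obtain ⟨a3, b3⟩ := rot_add_two h (m + 1)
  obtain ⟨a4, b4⟩ := rot_add_two h (m + 2)
  obtain ⟨a5, b5⟩ := rot_add_two h (m + 3)
  obtain ⟨a6, b6⟩ := rot_add_two h (m + 4)
  simp only [add_assoc, Nat.reduceAdd] at a2 a3 a4 a5 a6 b2 b3 b4 b5 b6
  rw [Fin.sum_univ_six]
  fin_cases l <;> simp [coeffs, basicSol]
  · ring
  · rw [a6, a5, a4, a3, a2]; ring
  · rw [b6, b5, b4, b3, b2]; ring
  · ring
  · rw [a6, a5, a4, a3, a2]; ring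
  · rw [b6, b5, b4, b3, b2]; ring

/-- Orthogonality of g to the windows of r^m and m r^m says that the polynomial with coefficients g
has a double root at r: divide by r^N and subtract N times the first relation from the second. -/
theorem isRoot_of_sums {g : Fin 6 → ℚ} {N : ℕ} {r : ℂ} (hr : r ≠ 0)
    (h0 : ∑ j : Fin 6, (g j : ℂ) * r ^ (N + j : ℕ) = 0)
    (h1 : ∑ j : Fin 6, (g j : ℂ) * ((N + j : ℕ) * r ^ (N + j : ℕ)) = 0) :
    (∑ j : Fin 6, Polynomial.C (g j : ℂ) * Polynomial.X ^ (j : ℕ)).IsRoot r ∧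
      (Polynomial.derivative
        (∑ j : Fin 6, Polynomial.C (g j : ℂ) * Polynomial.X ^ (j : ℕ))).IsRoot r := by
  have e0 : ∑ j : Fin 6, (g j : ℂ) * r ^ (j : ℕ) = 0 := by
    refine (mul_eq_zero.1 ?_).resolve_left (pow_ne_zero N hr)
    rw [← h0, Finset.mul_sum]
    exact Finset.sum_congr rfl fun j _ => by rw [pow_add]; ring
  have e1 : ∑ j : Fin 6, (g j : ℂ) * (j * r ^ (j : ℕ)) = 0 := by
    refine (mul_eq_zero.1 ?_).resolve_left (pow_ne_zero N hr)
    have : ∑ j : Fin 6, (g j : ℂ) * ((N + j : ℕ) * r ^ (N + j : ℕ))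
        = N * r ^ N * (∑ j : Fin 6, (g j : ℂ) * r ^ (j : ℕ)) +
          r ^ N * ∑ j : Fin 6, (g j : ℂ) * (j * r ^ (j : ℕ)) := by
      rw [Finset.mul_sum, Finset.mul_sum, ← Finset.sum_add_distrib]
      exact Finset.sum_congr rfl fun j _ => by rw [pow_add]; push_cast; ring
    rw [h1, e0] at this
    linear_combination -this
  constructor
  · simpa [Polynomial.IsRoot, Polynomial.eval_finsetSum] using e0
  · refine (mul_eq_zero.1 ?_).resolve_left hr
    rw [← e1]
    simp [Fin.sum_univ_six]
    ring

/-- A kernel vector would be the coefficient vector of a nonzero polynomial of degree below 6 with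
double roots at the three distinct points 1 and p ± qi. -/
theorem det_casorati_ne_zero (h : p ^ 2 + q ^ 2 = 1) (hq : q ≠ 0) (N : ℕ) :
    (casorati p q N).det ≠ 0 := by
  intro hdet
  obtain ⟨g, hg0, hg⟩ := Matrix.exists_mulVec_eq_zero_iff.2 hdet
  have hrow : ∀ l, ∑ j : Fin 6, basicSol p q (N + j) l * g j = 0 := fun l => by
    simpa [Matrix.mulVec, dotProduct, casorati] using congrFun hg l
  have hrowC : ∀ l, ∑ j : Fin 6, (basicSol p q (N + j) l : ℂ) * (g j : ℂ) = 0 := fun l => by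
    exact_mod_cast congrArg (fun t : ℚ => (t : ℂ)) (hrow l)
  set z : ℂ := (p : ℂ) + q * Complex.I with hz
  set z' : ℂ := (p : ℂ) - q * Complex.I with hz'
  have hzz : z * z' = 1 := by
    have : ((p : ℂ)) ^ 2 + (q : ℂ) ^ 2 = 1 := by exact_mod_cast congrArg (fun t : ℚ => (t : ℂ)) h
    rw [hz, hz']
    linear_combination this - (q : ℂ) ^ 2 * Complex.I_sq
  set G : Polynomial ℂ := ∑ j : Fin 6, Polynomial.C (g j : ℂ) * Polynomial.X ^ (j : ℕ) with hG
  have r1 := isRoot_of_sums (g := g) (N := N) (r := 1) one_ne_zero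
    (by
      rw [← hrowC 3]
      exact Finset.sum_congr rfl fun j _ => by simp [basicSol])
    (by
      rw [← hrowC 0]
      exact Finset.sum_congr rfl fun j _ => by simp [basicSol, mul_comm])
  -- The rows contain real and imaginary parts; adding ±i times one row to another gives the powers
  -- of p ± qi.
  have comb : ∀ (a b : Fin 6) (t : ℂ) (F : Fin 6 → ℂ),
      (∀ j : Fin 6, F j = (basicSol p q (N + j) a : ℂ) * (g j : ℂ) +
        t * ((basicSol p q (N + j) b : ℂ) * (g j : ℂ))) → ∑ j, F j = 0 := by
    intro a b t F hF
    simp only [hF, Finset.sum_add_distrib, ← Finset.mul_sum, hrowC]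
    simp
  have r2 := isRoot_of_sums (g := g) (N := N) (r := z) (left_ne_zero_of_mul_eq_one hzz)
    (comb 4 5 Complex.I _ fun j => by
      rw [← (rot_complex _).1]
      simp [basicSol]
      ring)
    (comb 1 2 Complex.I _ fun j => by
      rw [← (rot_complex _).1]
      simp [basicSol]
      ring)
  have r3 := isRoot_of_sums (g := g) (N := N) (r := z') (right_ne_zero_of_mul_eq_one hzz)
    (comb 4 5 (-Complex.I) _ fun j => by
      rw [← (rot_complex _).2]
      simp [basicSol]
      ring)
    (comb 1 2 (-Complex.I) _ fun j => by
      rw [← (rot_complex _).2]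
      simp [basicSol]
      ring)
  have hdeg : G.degree < 6 := Polynomial.degree_sum_fin_lt _
  have hGne : G ≠ 0 := by
    obtain ⟨j, hj⟩ := Function.ne_iff.1 hg0
    intro h0
    have hc : G.coeff j = (g j : ℂ) := by
      rw [hG, Polynomial.finsetSum_coeff, Finset.sum_eq_single j]
      · simp
      · intro i _ hij
        rw [Polynomial.coeff_C_mul_X_pow, if_neg fun e => hij (Fin.ext e.symm)]
      · simp
    rw [h0, Polynomial.coeff_zero] at hc
    exact hj (by exact_mod_cast hc.symm)
  have hqC : (q : ℂ) ≠ 0 := by exact_mod_cast hq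
  have d23 : z ≠ z' := by
    intro e
    have : 2 * (q : ℂ) * Complex.I = 0 := by rw [hz, hz'] at e; linear_combination e
    simp [hqC] at this
  have d12 : (1 : ℂ) ≠ z := by
    intro e
    have := congrArg Complex.im e
    simp [hz] at this
    exact hq (by exact_mod_cast this.symm)
  have d13 : (1 : ℂ) ≠ z' := by
    intro e
    have := congrArg Complex.im e
    simp [hz'] at this
    exact hq (by exact_mod_cast this)
  have m1 := (Polynomial.one_lt_rootMultiplicity_iff_isRoot hGne).2 r1
  have m2 := (Polynomial.one_lt_rootMultiplicity_iff_isRoot hGne).2 r2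
  have m3 := (Polynomial.one_lt_rootMultiplicity_iff_isRoot hGne).2 r3
  rw [← Polynomial.count_roots] at m1 m2 m3
  have hsub : ({1, z, z'} : Finset ℂ) ⊆ G.roots.toFinset := by
    intro r hr
    simp only [Finset.mem_insert, Finset.mem_singleton] at hr
    rw [Multiset.mem_toFinset, ← Multiset.one_le_count_iff_mem]
    rcases hr with rfl | rfl | rfl <;> omega
  have hcard := Finset.sum_le_sum_of_subset (f := fun r => G.roots.count r) hsub
  rw [Multiset.toFinset_sum_count_eq, Finset.sum_insert (by simp [d12, d13]),
    Finset.sum_insert (by simp [d23]), Finset.sum_singleton] at hcard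
  have h5 : G.natDegree < 6 := (Polynomial.natDegree_lt_iff_degree_lt hGne).2 hdeg
  have := G.card_roots'
  omega

end Rational

/-! ### Initial configurations -/

/-- The solution with initial configuration given by a combination of basic solutions. -/
theorem lrs_eq_of_basicSol {p q : ℚ} (h : p ^ 2 + q ^ 2 = 1) (N : ℕ) (y : Fin 6 → ℝ)
    (c : EuclideanSpace ℝ (Fin 6))
    (hc : ∀ j : Fin 6, c j = ∑ l, y l * (basicSol p q (N + j) l : ℝ)) (n : ℕ) :
    lrs (coeffs p) c n = ∑ l, y l * (basicSol p q (N + n) l : ℝ) := by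
  refine (LinearRecurrence.eq_mk_of_is_sol_of_eq_init
    (LinearRecurrence.mk 6 fun j => ((coeffs p j : ℚ) : ℝ)) (init := c.ofLp)
    (u := fun n => ∑ l, y l * (basicSol p q (N + n) l : ℝ)) ?_ ?_ n).symm
  · intro n
    simp only [← add_assoc, basicSol_add_six h]
    push_cast
    simp only [Finset.mul_sum]
    rw [Finset.sum_comm]
    exact Finset.sum_congr rfl fun j _ => Finset.sum_congr rfl fun l _ => by
      ring
  · exact fun j => (hc j).symm

/-- The coordinates of `lrs` as a linear functional of the initial configuration. -/
noncomputable def evalVec (p q : ℚ) (N n : ℕ) : EuclideanSpace ℝ (Fin 6) :=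
  WithLp.toLp 2 fun i => (((casorati p q N)⁻¹.mulVec (basicSol p q (N + n)) i : ℚ) : ℝ)

/-- The direction in which the vectors `evalVec` with small angles grow. -/
noncomputable def growth (p q : ℚ) (N : ℕ) : Fin 6 → ℚ := fun i =>
  (casorati p q N)⁻¹ i 0 + (casorati p q N)⁻¹ i 1

/-- The direction `growth`, as a vector of Euclidean space. -/
noncomputable def growthVec (p q : ℚ) (N : ℕ) : EuclideanSpace ℝ (Fin 6) :=
  WithLp.toLp 2 fun i => (growth p q N i : ℝ)

/-- The initial configuration of the sequence `m * (1 - cos m φ) - b * sin m φ`, `m = N + n`. -/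
def tangentInit (p q : ℚ) (N : ℕ) (b : ℚ) : Fin 6 → ℚ := fun j =>
  ((N + j : ℕ) : ℚ) * (1 - (rot p q (N + j)).1) - b * (rot p q (N + j)).2

/-- The initial configuration `tangentInit`, as a vector of Euclidean space. -/
noncomputable def tangentVec (p q : ℚ) (N : ℕ) (b : ℚ) : EuclideanSpace ℝ (Fin 6) :=
  WithLp.toLp 2 fun i => (tangentInit p q N b i : ℝ)

/-- The centre of the ball that touches the relevant half-spaces in `tangentVec`. -/
noncomputable def centre (p q : ℚ) (N : ℕ) (b ρ : ℚ) : EuclideanSpace ℝ (Fin 6) :=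
  tangentVec p q N b + ((ρ : ℝ) / ‖growthVec p q N‖) • growthVec p q N

/-- The sum of the squares of the entries of the inverse of `casorati`. -/
noncomputable def invSize (p q : ℚ) (N : ℕ) : ℚ := ∑ i, ∑ l, (casorati p q N)⁻¹ i l ^ 2

/-- The square of the length of `growthVec`. -/
noncomputable def growthSq (p q : ℚ) (N : ℕ) : ℚ := ∑ i, growth p q N i ^ 2

/-! ### Evaluation functionals and the ball touching the tangent configuration -/

section Geometry

open scoped RealInnerProductSpace

variable {p q : ℚ} (h : p ^ 2 + q ^ 2 = 1) (hq : q ≠ 0) (N n : ℕ)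

include h hq

theorem casorati_inv_mul : (casorati p q N)⁻¹ * casorati p q N = 1 :=
  Matrix.nonsing_inv_mul _ (det_casorati_ne_zero h hq N).isUnit

theorem casorati_mul_inv : casorati p q N * (casorati p q N)⁻¹ = 1 :=
  Matrix.mul_nonsing_inv _ (det_casorati_ne_zero h hq N).isUnit

/-- The inverse Casorati matrix turns c into coordinates with respect to the basic solutions. Sign
conditions on the sequence thereby become half-space conditions on c. -/
theorem lrs_eq_inner (c : EuclideanSpace ℝ (Fin 6)) :
    lrs (coeffs p) c n = ⟪c, evalVec p q N n⟫ := by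
  rw [lrs_eq_of_basicSol h N (fun l => ∑ i, c i * ((casorati p q N)⁻¹ i l : ℝ)) c]
  · simp only [PiLp.inner_apply, evalVec, Matrix.mulVec, dotProduct]
    simp only [Finset.sum_mul]
    rw [Finset.sum_comm]
    refine Finset.sum_congr rfl fun i _ => ?_
    push_cast
    simp [Finset.mul_sum, mul_assoc, mul_comm]
  · intro j
    simp only [Finset.sum_mul]
    rw [Finset.sum_comm]
    have : ∀ i, ∑ l, c i * ((casorati p q N)⁻¹ i l : ℝ) * (basicSol p q (N + j) l : ℝ)
        = c i * (((1 : Matrix (Fin 6) (Fin 6) ℚ) i j : ℚ) : ℝ) := by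
      intro i
      rw [← casorati_inv_mul h hq N, Matrix.mul_apply]
      push_cast
      rw [Finset.mul_sum]
      exact Finset.sum_congr rfl fun l _ => by simp [casorati, mul_assoc]
    simp only [this, Matrix.one_apply]
    rw [Finset.sum_eq_single j]
    · simp
    · intro i _ hij
      simp [hij]
    · simp

omit hq in
theorem lrs_tangentVec (b : ℚ) :
    lrs (coeffs p) (tangentVec p q N b) n
      = ((N + n : ℕ) : ℝ) * (1 - (rot p q (N + n)).1) - b * (rot p q (N + n)).2 := by
  rw [lrs_eq_of_basicSol h N ![1, -1, 0, 0, 0, -(b : ℝ)]]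
  · simp [Fin.sum_univ_six, basicSol]
    ring
  · intro j
    simp [Fin.sum_univ_six, basicSol, tangentVec, tangentInit]
    ring

/-- When the angle mφ is nearly a multiple of 2π, m times this right-hand side is the dominant part
of `basicSol`. So the evaluation vector is nearly m times `growth`. -/
theorem casorati_mulVec_growth :
    (casorati p q N).mulVec (growth p q N) = Pi.single 0 1 + Pi.single 1 1 := by
  have : growth p q N = (casorati p q N)⁻¹.mulVec (Pi.single 0 1 + Pi.single 1 1) := by
    ext i
    simp [growth, Matrix.mulVec_add]
  rw [this, Matrix.mulVec_mulVec, casorati_mul_inv h hq, Matrix.one_mulVec]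

theorem growthSq_pos : 0 < growthSq p q N := by
  refine lt_of_le_of_ne (Finset.sum_nonneg fun i _ => sq_nonneg _) fun h0 => ?_
  have h1 : growth p q N = 0 := by
    ext i
    have := (Finset.sum_eq_zero_iff_of_nonneg (fun i _ => sq_nonneg (growth p q N i))).1 h0.symm i
      (Finset.mem_univ i)
    simpa using this
  have h2 := congrFun (casorati_mulVec_growth h hq N) 0
  rw [h1] at h2
  simp at h2

omit h hq in
theorem norm_growthVec : ‖growthVec p q N‖ = √(growthSq p q N : ℝ) := by
  rw [EuclideanSpace.norm_eq]
  congr 1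
  simp only [growthVec, growthSq, Real.norm_eq_abs, sq_abs]
  push_cast
  rfl

theorem norm_growthVec_pos : 0 < ‖growthVec p q N‖ := by
  rw [norm_growthVec]
  exact Real.sqrt_pos.2 (by exact_mod_cast growthSq_pos h hq N)

/-- Writing ρ/‖g‖ as ρ‖g‖/‖g‖² exhibits the entries in the form α + β√δ with rational α, β, δ, as
`exists_algCode` requires. -/
theorem centre_apply (b ρ : ℚ) (j : Fin 6) :
    centre p q N b ρ j = ((tangentInit p q N b j : ℚ) : ℝ) +
      ((ρ * growth p q N j / growthSq p q N : ℚ) : ℝ) * √(growthSq p q N : ℝ) := by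
  have h0 : (0 : ℝ) < (growthSq p q N : ℝ) := by exact_mod_cast growthSq_pos h hq N
  have h1 := Real.sqrt_pos.2 h0
  have h2 := Real.sq_sqrt h0.le
  simp only [centre, PiLp.add_apply, PiLp.smul_apply, smul_eq_mul, norm_growthVec]
  simp only [tangentVec, growthVec]
  push_cast
  congr 1
  rw [div_mul_eq_mul_div, div_mul_eq_mul_div, div_eq_div_iff h1.ne' h0.ne']
  nth_rw 1 [← h2]
  ring

/-- The entries of `evalVec` add up to one. -/
theorem sum_evalVec : ∑ i, evalVec p q N n i = 1 := by
  -- Row 3 of `casorati` consists of ones, since the constant 1 is a basic solution.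
  have h1 : (casorati p q N).mulVec ((casorati p q N)⁻¹.mulVec (basicSol p q (N + n))) 3
      = basicSol p q (N + n) 3 := by
    rw [Matrix.mulVec_mulVec, casorati_mul_inv h hq, Matrix.one_mulVec]
  have h2 : ∑ i, (casorati p q N)⁻¹.mulVec (basicSol p q (N + n)) i = 1 := by
    have h3 : basicSol p q (N + n) 3 = 1 := by simp [basicSol]
    rw [← h3, ← h1, Matrix.mulVec, dotProduct]
    exact Finset.sum_congr rfl fun j _ => by simp [casorati, basicSol]
  simp only [evalVec]
  exact_mod_cast congrArg (fun t : ℚ => (t : ℝ)) h2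

/-- By Cauchy–Schwarz the norm is at least 1/√6 > 2/5. Only 2/5 > 1/3 matters: it beats the grid
step η ≤ ρ/3 in the Skolem argument. -/
theorem two_fifths_le_norm_evalVec : 2 / 5 ≤ ‖evalVec p q N n‖ := by
  have h1 := sum_evalVec h hq N n
  have h2 : (∑ i, evalVec p q N n i) ^ 2 ≤ 6 * ‖evalVec p q N n‖ ^ 2 := by
    rw [EuclideanSpace.norm_sq_eq]
    simpa using sq_sum_le_card_mul_sum_sq (s := Finset.univ) (f := fun i => evalVec p q N n i)
  rw [h1] at h2
  nlinarith [norm_nonneg (evalVec p q N n)]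

omit hq in
/-- `evalVec` is close to a multiple of `growthVec` if the angle is small. -/
theorem norm_evalVec_sub_sq_le :
    ‖evalVec p q N n - ((N + n : ℕ) : ℝ) • growthVec p q N‖ ^ 2
      ≤ invSize p q N * (2 * ((N + n : ℕ) : ℝ) ^ 2 * (1 - (rot p q (N + n)).1) + 2) := by
  set m := N + n
  -- What is left of `basicSol` after removing m in the first two coordinates; Cauchy–Schwarz in
  -- each row of the inverse matrix then gives the bound.
  set y : Fin 6 → ℚ := ![0, m * ((rot p q m).1 - 1), m * (rot p q m).2, 1, (rot p q m).1,
    (rot p q m).2] with hy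
  have hyy : ∑ l, y l ^ 2 = 2 * (m : ℚ) ^ 2 * (1 - (rot p q m).1) + 2 := by
    simp only [Fin.sum_univ_six, hy]
    simp
    linear_combination ((m : ℚ) ^ 2 + 1) * rot_sq_add_sq h m
  have hdec : ∀ i, (casorati p q N)⁻¹.mulVec (basicSol p q m) i - m * growth p q N i
      = ∑ l, (casorati p q N)⁻¹ i l * y l := by
    intro i
    simp only [Matrix.mulVec, dotProduct, growth, Fin.sum_univ_six, hy, basicSol]
    simp
    ring
  have key : ∑ i, (∑ l, (casorati p q N)⁻¹ i l * y l) ^ 2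
      ≤ invSize p q N * (2 * (m : ℚ) ^ 2 * (1 - (rot p q m).1) + 2) := by
    rw [invSize, ← hyy, Finset.sum_mul]
    exact Finset.sum_le_sum fun i _ => Finset.sum_mul_sq_le_sq_mul_sq _ _ _
  have hn : ‖evalVec p q N n - (m : ℝ) • growthVec p q N‖ ^ 2
      = ((∑ i, (∑ l, (casorati p q N)⁻¹ i l * y l) ^ 2 : ℚ) : ℝ) := by
    rw [EuclideanSpace.norm_sq_eq]
    push_cast
    refine Finset.sum_congr rfl fun i _ => ?_
    have := congrArg (fun t : ℚ => (t : ℝ)) (hdec i)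
    push_cast at this
    rw [← this]
    simp [evalVec, growthVec, m]
  rw [hn]
  exact_mod_cast key

omit h hq in
/-- Second order comparison of a vector with its projection to a line. -/
theorem norm_sub_inner_le {E : Type*} [NormedAddCommGroup E] [InnerProductSpace ℝ E] {g v : E}
    (hg : g ≠ 0) {m : ℝ} (hm : 0 < m) :
    ‖v‖ - ⟪g, v⟫ / ‖g‖ ≤ 4 * ‖v - m • g‖ ^ 2 / (m * ‖g‖) := by
  have hg0 : 0 < ‖g‖ := norm_pos_iff.2 hg
  obtain ⟨z, rfl⟩ : ∃ z, v = m • g + z := ⟨v - m • g, by abel⟩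
  rw [add_sub_cancel_left]
  set G := ‖g‖
  set Z := ‖z‖
  have hZ : 0 ≤ Z := norm_nonneg z
  set t := ⟪g, z⟫ / G with ht
  have hgz : ⟪g, z⟫ = t * G := by rw [ht]; field_simp
  have htZ : |t| ≤ Z := by
    rw [ht, abs_div, abs_of_pos hg0, div_le_iff₀ hg0, mul_comm]
    exact abs_real_inner_le_norm g z
  have ha : ⟪g, m • g + z⟫ / G = m * G + t := by
    rw [inner_add_right, inner_smul_right, real_inner_self_eq_norm_sq, hgz]
    change (m * G ^ 2 + t * G) / G = m * G + t
    field_simp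
  -- Pythagoras: mG + t is the component along g, and Z² - t² is the squared length of the
  -- orthogonal part.
  have hv : ‖m • g + z‖ ^ 2 = (m * G + t) ^ 2 + (Z ^ 2 - t ^ 2) := by
    rw [norm_add_sq_real, inner_smul_left, hgz, norm_smul, Real.norm_eq_abs, abs_of_pos hm]
    simp
    ring
  rw [ha]
  set V := ‖m • g + z‖
  have hV : 0 ≤ V := norm_nonneg _
  have hmG : 0 < m * G := mul_pos hm hg0
  have ht' := abs_le.1 htZ
  rw [le_div_iff₀ hmG]
  -- If Z ≤ mG/2, a difference of squares is divided by V + (mG + t) ≥ mG. Otherwise the trivial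
  -- bound 2Z is already below 4Z²/(mG).
  by_cases hc : Z ≤ m * G / 2
  · have h1 : m * G / 2 ≤ m * G + t := by linarith
    have h2 : m * G / 2 ≤ V := by nlinarith [mul_self_nonneg (Z - |t|), sq_abs t, abs_nonneg t]
    have h3 : (V - (m * G + t)) * (V + (m * G + t)) ≤ Z ^ 2 := by nlinarith [sq_nonneg t]
    have h4 : 0 ≤ V - (m * G + t) := by
      by_contra hcon
      nlinarith [sq_abs t, abs_nonneg t]
    nlinarith
  · have h1 : V ≤ m * G + Z := by
      refine abs_le_of_sq_le_sq' ?_ (by linarith) |>.2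
      nlinarith
    nlinarith

/-- If the ball around `centre` is not strictly on the positive side, the angle is small. -/
theorem small_of_inner_centre_le {b ρ δ : ℚ} (hρ : 0 ≤ ρ) (hm : 0 < N + n)
    (hδ : ρ * (8 * invSize p q N * (1 + 1 / growthSq p q N)) ≤ δ)
    (hle : ⟪centre p q N b ρ, evalVec p q N n⟫ ≤ ρ * ‖evalVec p q N n‖) :
    (1 - δ) * (N + n : ℕ) * (1 - (rot p q (N + n)).1) - b * (rot p q (N + n)).2
      ≤ (δ : ℝ) / (N + n : ℕ) := by
  have hmR : (0 : ℝ) < (N + n : ℕ) := by exact_mod_cast hm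
  have hG := norm_growthVec_pos h hq N
  have e1 := norm_sub_inner_le (v := evalVec p q N n) (norm_pos_iff.1 hG) hmR
  have e2 := norm_evalVec_sub_sq_le h N n
  have e3 := lrs_tangentVec h N n b
  rw [lrs_eq_inner h hq N n] at e3
  rw [centre, inner_add_left, inner_smul_left, e3] at hle
  simp only [conj_trivial] at hle
  have hsq : ‖growthVec p q N‖ ^ 2 = (growthSq p q N : ℝ) := by
    rw [norm_growthVec, Real.sq_sqrt (by exact_mod_cast (growthSq_pos h hq N).le)]
  have hρR : (0 : ℝ) ≤ (ρ : ℝ) := by exact_mod_cast hρ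
  have hδR : (ρ : ℝ) * (8 * invSize p q N * (1 + 1 / growthSq p q N)) ≤ (δ : ℝ) := by
    exact_mod_cast hδ
  rw [← hsq] at hδR
  set G := ‖growthVec p q N‖
  set V := ‖evalVec p q N n‖
  set m : ℝ := ((N + n : ℕ) : ℝ)
  set x : ℝ := ((rot p q (N + n)).1 : ℝ)
  set y : ℝ := ((rot p q (N + n)).2 : ℝ)
  set Γ : ℝ := (invSize p q N : ℝ)
  have hΓ : 0 ≤ Γ := by
    have : 0 ≤ invSize p q N :=
      Finset.sum_nonneg fun i _ => Finset.sum_nonneg fun l _ => sq_nonneg _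
    simp only [Γ]
    exact_mod_cast this
  have hx : 0 ≤ 1 - x := by
    have : (rot p q (N + n)).1 ≤ 1 := by
      nlinarith [rot_sq_add_sq h (N + n), sq_nonneg (rot p q (N + n)).2]
    have : x ≤ 1 := by simp only [x]; exact_mod_cast this
    linarith
  -- The length G need not be rational, so 1/G is replaced by a bound that is rational in G².
  have hinv : 1 / G ≤ 1 + 1 / G ^ 2 := by
    rw [one_div, one_div, ← inv_pow]
    nlinarith [sq_nonneg (G⁻¹ - 1), inv_pos.2 hG]
  have hconj : (ρ : ℝ) / G * ⟪growthVec p q N, evalVec p q N n⟫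
      = ρ * (⟪growthVec p q N, evalVec p q N n⟫ / G) := by ring
  rw [hconj] at hle
  have e4 : 4 * ‖evalVec p q N n - m • growthVec p q N‖ ^ 2 / (m * G)
      ≤ 8 * Γ * (1 + 1 / G ^ 2) * (m * (1 - x) + 1 / m) := by
    calc 4 * ‖evalVec p q N n - m • growthVec p q N‖ ^ 2 / (m * G)
        ≤ 4 * (Γ * (2 * m ^ 2 * (1 - x) + 2)) / (m * G) := by gcongr
      _ = 8 * Γ * (1 / G) * (m * (1 - x) + 1 / m) := by field_simp; ring
      _ ≤ _ := by gcongr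
  have hpos : 0 ≤ m * (1 - x) + 1 / m := by positivity
  have e5 : m * (1 - x) - b * y ≤ δ * (m * (1 - x) + 1 / m) := by
    calc m * (1 - x) - b * y
        ≤ ρ * (‖evalVec p q N n‖ - ⟪growthVec p q N, evalVec p q N n⟫ / G) := by linarith
      _ ≤ ρ * (8 * Γ * (1 + 1 / G ^ 2) * (m * (1 - x) + 1 / m)) :=
          mul_le_mul_of_nonneg_left (e1.trans e4) hρR
      _ = ρ * (8 * Γ * (1 + 1 / G ^ 2)) * (m * (1 - x) + 1 / m) := by ring
      _ ≤ _ := mul_le_mul_of_nonneg_right hδR hpos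
  have e6 : (δ : ℝ) / m = δ * (1 / m) := by ring
  rw [e6]
  linarith

end Geometry

end RobustLRS


namespace RobustLRS

/-! ### Balls and half-spaces -/

section Balls

open scoped RealInnerProductSpace

variable {E : Type*} [NormedAddCommGroup E] [InnerProductSpace ℝ E]

theorem inner_nonneg_on_closedBall {c v : E} {r : ℝ} (hr : 0 < r)
    (hb : ∀ x ∈ Metric.ball c r, 0 ≤ ⟪x, v⟫) : ∀ x ∈ Metric.closedBall c r, 0 ≤ ⟪x, v⟫ := by
  rw [← closure_ball c hr.ne']
  have hcl : IsClosed {x : E | 0 ≤ ⟪x, v⟫} :=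
    isClosed_le continuous_const (continuous_id.inner continuous_const)
  exact fun x hx => closure_minimal hb hcl hx

/-- Test the point of the closed ball that is farthest in the direction -v. -/
theorem mul_norm_le_inner_of_nonneg {c v : E} {r : ℝ} (hr : 0 ≤ r)
    (hb : ∀ x ∈ Metric.closedBall c r, 0 ≤ ⟪x, v⟫) : r * ‖v‖ ≤ ⟪c, v⟫ := by
  rcases eq_or_ne v 0 with rfl | hv
  · simp
  have hv0 : 0 < ‖v‖ := norm_pos_iff.2 hv
  have hx : c - (r / ‖v‖) • v ∈ Metric.closedBall c r := by
    rw [Metric.mem_closedBall, dist_eq_norm, sub_sub_cancel_left, norm_neg, norm_smul,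
      Real.norm_eq_abs, abs_of_nonneg (by positivity), div_mul_cancel₀ _ hv0.ne']
  have := hb _ hx
  rw [inner_sub_left, inner_smul_left, real_inner_self_eq_norm_sq] at this
  have e : (r / ‖v‖) * ‖v‖ ^ 2 = r * ‖v‖ := by field_simp
  simp only [conj_trivial, e] at this
  linarith

theorem inner_pos_of_mul_norm_lt {c v x : E} {r : ℝ} (hlt : r * ‖v‖ < ⟪c, v⟫)
    (hx : x ∈ Metric.closedBall c r) : 0 < ⟪x, v⟫ := by
  rw [Metric.mem_closedBall, dist_eq_norm] at hx
  have h1 := (abs_le.1 (abs_real_inner_le_norm (x - c) v)).1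
  have h2 : ‖x - c‖ * ‖v‖ ≤ r * ‖v‖ := mul_le_mul_of_nonneg_right hx (norm_nonneg v)
  rw [inner_sub_left] at h1
  linarith

/-- A nonvanishing continuous function on a convex, hence connected, set has constant sign. -/
theorem inner_pos_on_ball {c v : E} {r : ℝ} (hne : ∀ x ∈ Metric.ball c r, ⟪x, v⟫ ≠ 0) {x₀ : E}
    (hx₀ : x₀ ∈ Metric.ball c r) (hpos : 0 < ⟪x₀, v⟫) : ∀ x ∈ Metric.ball c r, 0 < ⟪x, v⟫ := by
  intro x hx
  by_contra hcon
  obtain ⟨z, hz, hz0⟩ := (convex_ball c r).isPreconnected.intermediate_value hx hx₀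
    (f := fun x : E => ⟪x, v⟫) (by fun_prop) ⟨not_lt.1 hcon, hpos.le⟩
  exact hne z hz hz0

end Balls

/-! ### What an answer to a robust problem says -/

section Detects

open scoped RealInnerProductSpace

/-- A robust problem that detects, for the family of recurrences above, if the inequality
`b * sin m φ ≤ m * (1 - cos m φ)` holds for most `m` in the sense of the filter `ℱ`. -/
def Detects (Q : RobustProperty 6)
    (B : EuclideanSpace ℝ (Fin 6) → ℝ → Set (EuclideanSpace ℝ (Fin 6))) (ℱ : Filter ℕ) : Prop :=
  ∀ (p q : ℚ) (N : ℕ) (ρ η ε : ℚ) (l : ℕ), p ^ 2 + q ^ 2 = 1 → q ≠ 0 →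
    (∀ m, 0 < m → (rot p q m).1 ≠ 1) → 0 < N → 0 < ρ → 0 ≤ η → η ≤ ρ / 3 → |ε| ≤ 1 →
    ((∀ i ≤ l, Q (coeffs p) (B (centre p q N (ε * (i * η)) ρ) ρ)) →
      ∀ᶠ n in ℱ, (0 : ℝ) ≤ (N + n : ℕ) * (1 - (rot p q (N + n)).1)
        - (ε * (l * η) : ℚ) * (rot p q (N + n)).2) ∧
    ((∀ᶠ n in ℱ, ρ * ‖evalVec p q N n‖ < ⟪centre p q N (ε * (l * η)) ρ, evalVec p q N n⟫) →
      Q (coeffs p) (B (centre p q N (ε * (l * η)) ρ) ρ))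

theorem tangentVec_mem_closedBall {p q : ℚ} (h : p ^ 2 + q ^ 2 = 1) (hq : q ≠ 0) (N : ℕ) (b : ℚ)
    {ρ : ℚ} (hρ : 0 < ρ) : tangentVec p q N b ∈ Metric.closedBall (centre p q N b ρ) (ρ : ℝ) := by
  have hρ' : (0 : ℝ) < ρ := by exact_mod_cast hρ
  have hg := norm_growthVec_pos h hq N
  rw [Metric.mem_closedBall, dist_eq_norm, centre, sub_add_cancel_left, norm_neg, norm_smul,
    Real.norm_eq_abs, abs_of_pos (by positivity), div_mul_cancel₀ _ hg.ne']

variable {B : EuclideanSpace ℝ (Fin 6) → ℝ → Set (EuclideanSpace ℝ (Fin 6))}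
  (hB : ∀ c r, Metric.ball c r ⊆ B c r ∧ B c r ⊆ Metric.closedBall c r)

include hB

/-- The tangent configuration is on the boundary, but nonnegativity on the open ball passes to the
closure. Conversely, the strict margin gives positivity on the closed ball, so open and closed balls
are treated alike. -/
theorem detects_robustPositivity : Detects (RobustPositivity 6) B ⊤ := by
  intro p q N ρ η ε l h hq _ _ hρ _ _ _
  have hρ' : (0 : ℝ) < ρ := by exact_mod_cast hρ
  constructor
  · intro hQ
    rw [Filter.eventually_top]
    intro n
    rw [← lrs_tangentVec h, lrs_eq_inner h hq N]
    refine inner_nonneg_on_closedBall hρ' (fun x hx => ?_) _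
      (tangentVec_mem_closedBall h hq N _ hρ)
    rw [← lrs_eq_inner h hq N]
    exact hQ l le_rfl x ((hB _ _).1 hx) n
  · intro hlt c hc n
    rw [lrs_eq_inner h hq N]
    exact (inner_pos_of_mul_norm_lt (Filter.eventually_top.1 hlt n) ((hB _ _).2 hc)).le

theorem detects_robustUniformUltimatePositivity :
    Detects (RobustUniformUltimatePositivity 6) B Filter.atTop := by
  intro p q N ρ η ε l h hq _ _ hρ _ _ _
  have hρ' : (0 : ℝ) < ρ := by exact_mod_cast hρ
  constructor
  · intro hQ
    obtain ⟨M, hM⟩ := hQ l le_rfl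
    filter_upwards [Filter.eventually_gt_atTop M] with n hn
    rw [← lrs_tangentVec h, lrs_eq_inner h hq N]
    refine inner_nonneg_on_closedBall hρ' (fun x hx => ?_) _
      (tangentVec_mem_closedBall h hq N _ hρ)
    rw [← lrs_eq_inner h hq N]
    exact hM x ((hB _ _).1 hx) n hn
  · intro hlt
    obtain ⟨M, hM⟩ := Filter.eventually_atTop.1 hlt
    refine ⟨M, fun c hc n hn => ?_⟩
    rw [lrs_eq_inner h hq N]
    exact (inner_pos_of_mul_norm_lt (hM n hn.le) ((hB _ _).2 hc)).le

omit hB in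
-- Here N depends on c, so there is no passage to the closure. The tangent configuration itself must
-- belong to the ball, which is why only closed balls occur.
theorem detects_robustNonUniformUltimatePositivity :
    Detects (RobustNonUniformUltimatePositivity 6) Metric.closedBall Filter.atTop := by
  intro p q N ρ η ε l h hq _ _ hρ _ _ _
  constructor
  · intro hQ
    obtain ⟨M, hM⟩ := hQ l le_rfl _ (tangentVec_mem_closedBall h hq N _ hρ)
    filter_upwards [Filter.eventually_gt_atTop M] with n hn
    rw [← lrs_tangentVec h]
    exact hM n hn
  · intro hlt c hc
    obtain ⟨M, hM⟩ := Filter.eventually_atTop.1 hlt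
    refine ⟨M, fun n hn => ?_⟩
    rw [lrs_eq_inner h hq N]
    exact (inner_pos_of_mul_norm_lt (hM n hn.le) hc).le

omit hB in
theorem inner_centre {p q : ℚ} (h : p ^ 2 + q ^ 2 = 1) (hq : q ≠ 0) (N n : ℕ) (b ρ : ℚ) :
    ⟪centre p q N b ρ, evalVec p q N n⟫
      = (N + n : ℕ) * (1 - (rot p q (N + n)).1) - b * (rot p q (N + n)).2
        + ρ / ‖growthVec p q N‖ * ⟪growthVec p q N, evalVec p q N n⟫ := by
  rw [centre, inner_add_left, ← lrs_eq_inner h hq N, lrs_tangentVec h, inner_smul_left]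
  simp

/-- For fixed n the sign is constant on each ball. It is positive for b = 0 and is transported from
one grid point to the next; this is the reason why `Detects` assumes the answers for all i ≤ l. -/
theorem detects_robustSkolem : Detects (RobustSkolem 6) B ⊤ := by
  intro p q N ρ η ε l h hq hne hN hρ hη hηρ hε
  have hρ' : (0 : ℝ) < ρ := by exact_mod_cast hρ
  have hηρ' : (η : ℝ) ≤ ρ / 3 := by exact_mod_cast hηρ
  have hη' : (0 : ℝ) ≤ η := by exact_mod_cast hη
  have hε' : |(ε : ℝ)| ≤ 1 := by exact_mod_cast hε
  constructor
  · intro hQ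
    rw [Filter.eventually_top]
    intro n
    have hnz : ∀ i ≤ l, ∀ x ∈ Metric.ball (centre p q N (ε * (i * η)) ρ) (ρ : ℝ),
        ⟪x, evalVec p q N n⟫ ≠ 0 := fun i hi x hx => by
      rw [← lrs_eq_inner h hq N]
      exact hQ i hi x ((hB _ _).1 hx) n
    have hclosed : ∀ i ≤ l, 0 < ⟪centre p q N (ε * (i * η)) ρ, evalVec p q N n⟫ →
        ∀ x ∈ Metric.closedBall (centre p q N (ε * (i * η)) ρ) (ρ : ℝ),
          0 ≤ ⟪x, evalVec p q N n⟫ := fun i hi hc =>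
      inner_nonneg_on_closedBall hρ' fun x hx =>
        (inner_pos_on_ball (hnz i hi) (Metric.mem_ball_self hρ') hc x hx).le
    have hpos : ∀ i ≤ l, 0 < ⟪centre p q N (ε * (i * η)) ρ, evalVec p q N n⟫ := by
      intro i
      induction i with
      | zero =>
        intro hi
        -- Were the centre on the negative side, the closed ball would be too. But for b = 0 the
        -- tangent configuration has the value m(1 - cos mφ) > 0, as mφ is not a multiple of 2π.
        by_contra hcon
        have hneg : 0 < ⟪centre p q N (ε * ((0 : ℕ) * η)) ρ, -evalVec p q N n⟫ := by
          rw [inner_neg_right, neg_pos]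
          exact lt_of_le_of_ne (not_lt.1 hcon) (hnz 0 hi _ (Metric.mem_ball_self hρ'))
        have := inner_nonneg_on_closedBall hρ' (fun x hx =>
          (inner_pos_on_ball (v := -evalVec p q N n)
            (fun x hx => by simpa [inner_neg_right] using hnz 0 hi x hx)
            (Metric.mem_ball_self hρ') hneg x hx).le) _ (tangentVec_mem_closedBall h hq N _ hρ)
        rw [inner_neg_right, ← lrs_eq_inner h hq N, lrs_tangentVec h] at this
        have hx : (rot p q (N + n)).1 < 1 := by
          refine lt_of_le_of_ne ?_ (hne _ (by omega))
          nlinarith [rot_sq_add_sq h (N + n), sq_nonneg (rot p q (N + n)).2]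
        have hx' : (0 : ℝ) < 1 - ((rot p q (N + n)).1 : ℝ) := by
          rw [sub_pos]; exact_mod_cast hx
        have hm : (0 : ℝ) < (N + n : ℕ) := by exact_mod_cast (by omega : 0 < N + n)
        have := mul_pos hm hx'
        norm_num at *
        linarith
      | succ i ih =>
        intro hi
        -- By the previous step the value at the old centre is at least ρ‖v‖ ≥ 2ρ/5; changing the
        -- parameter by εη changes it by at most η ≤ ρ/3.
        have h1 := mul_norm_le_inner_of_nonneg hρ'.le (hclosed i (by omega) (ih (by omega)))
        have h2 := two_fifths_le_norm_evalVec h hq N n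
        have hy : |((rot p q (N + n)).2 : ℝ)| ≤ 1 := by
          have h3 : ((rot p q (N + n)).1 : ℝ) ^ 2 + ((rot p q (N + n)).2 : ℝ) ^ 2 = 1 := by
            exact_mod_cast rot_sq_add_sq h (N + n)
          rw [abs_le]
          constructor <;> nlinarith [sq_nonneg ((rot p q (N + n)).1 : ℝ)]
        have hεy : (ε : ℝ) * η * (rot p q (N + n)).2 ≤ η := by
          calc (ε : ℝ) * η * (rot p q (N + n)).2 ≤ |(ε : ℝ) * η * (rot p q (N + n)).2| :=
              le_abs_self _
            _ = |(ε : ℝ)| * η * |((rot p q (N + n)).2 : ℝ)| := by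
              rw [abs_mul, abs_mul, abs_of_nonneg hη']
            _ ≤ 1 * η * 1 := by gcongr
            _ = η := by ring
        rw [inner_centre h hq] at h1 ⊢
        push_cast at h1 ⊢
        nlinarith [mul_le_mul_of_nonneg_left h2 hρ'.le]
    rw [← lrs_tangentVec h, lrs_eq_inner h hq N]
    exact hclosed l le_rfl (hpos l le_rfl) _ (tangentVec_mem_closedBall h hq N _ hρ)
  · intro hlt c hc n
    rw [lrs_eq_inner h hq N]
    exact (inner_pos_of_mul_norm_lt (Filter.eventually_top.1 hlt n) ((hB _ _).2 hc)).ne'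

end Detects

end RobustLRS


namespace RobustLRS

/-! ### Angles and Diophantine approximation -/

theorem rot_eq_cos_sin {p q : ℚ} {φ : ℝ} (hp : (p : ℝ) = Real.cos φ) (hq : (q : ℝ) = Real.sin φ)
    (m : ℕ) : ((rot p q m).1 : ℝ) = Real.cos (m * φ) ∧ ((rot p q m).2 : ℝ) = Real.sin (m * φ) := by
  induction m with
  | zero => simp [rot]
  | succ m ih =>
    simp only [rot]
    push_cast
    rw [ih.1, ih.2, hp, hq, add_mul, one_mul, Real.cos_add, Real.sin_add]
    constructor <;> ring

/-- With the half angle y = π(mθ - r), m(1 - cos) - b sin factors as 2 sin y (m sin y - b cos y). -/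
theorem cos_sin_eq_of_sub_int (θ : ℝ) (m : ℕ) (r : ℤ) :
    Real.cos (m * (2 * Real.pi * θ)) = 1 - 2 * Real.sin (Real.pi * (m * θ - r)) ^ 2 ∧
      Real.sin (m * (2 * Real.pi * θ))
        = 2 * Real.sin (Real.pi * (m * θ - r)) * Real.cos (Real.pi * (m * θ - r)) := by
  have h : (m : ℝ) * (2 * Real.pi * θ) = 2 * (Real.pi * (m * θ - r)) + r * (2 * Real.pi) := by ring
  rw [h, Real.cos_add_int_mul_two_pi, Real.sin_add_int_mul_two_pi, Real.sin_two_mul,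
    Real.cos_two_mul, Real.cos_sq']
  exact ⟨by ring, rfl⟩

/-- Each of the two inequalities is informative for one sign of y only; the relevant one gives b
cos|y| ≤ m sin|y| ≤ m|y|. If m|y| < b ≤ 5, then |y| ≤ 1/(20k), so replacing cos|y| by 1 costs less
than 1/(100k). -/
theorem le_pi_mul_of_nonneg {θ : ℝ} (hθ : Irrational θ) {k m : ℕ} (hk : 0 < k)
    (hm : 100 * k ≤ m) {b : ℝ} (hb0 : 0 ≤ b) (hb5 : b ≤ 5)
    (h1 : 0 ≤ m * (1 - Real.cos (m * (2 * Real.pi * θ))) - b * Real.sin (m * (2 * Real.pi * θ)))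
    (h2 : 0 ≤ m * (1 - Real.cos (m * (2 * Real.pi * θ))) + b * Real.sin (m * (2 * Real.pi * θ)))
    (r : ℤ) : b - 1 / (100 * k) ≤ Real.pi * (m * |m * θ - r|) := by
  have hkR : (1 : ℝ) ≤ k := by exact_mod_cast hk
  have hmR : 100 * (k : ℝ) ≤ m := by exact_mod_cast hm
  have hm0 : (0 : ℝ) < m := by linarith
  have hne : (m : ℝ) * θ - r ≠ 0 := by
    have := (hθ.natCast_mul (m := m) (by rintro rfl; simp at hm0)).sub_intCast r
    exact this.ne_zero
  rw [(cos_sin_eq_of_sub_int θ m r).1, (cos_sin_eq_of_sub_int θ m r).2] at h1 h2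
  set y := Real.pi * (m * θ - r) with hy
  have hyabs : Real.pi * (m * |m * θ - r|) = m * |y| := by
    rw [hy, abs_mul, abs_of_pos Real.pi_pos]; ring
  rw [hyabs]
  by_contra hcon
  push Not at hcon
  have hkinv : 0 < 1 / (100 * (k : ℝ)) := by positivity
  have hmy : m * |y| < b := by linarith
  have hy5 : 100 * k * |y| ≤ 5 := by nlinarith [abs_nonneg y]
  have hy1 : |y| ≤ 1 / 20 := by nlinarith [abs_nonneg y]
  have hy0 : 0 < |y| := abs_pos.2 (mul_ne_zero Real.pi_ne_zero hne)
  -- pass to the absolute value of `y`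
  have key : ∀ t : ℝ, 0 < t → t ≤ 1 / 20 →
      0 ≤ m * (2 * Real.sin t ^ 2) - b * (2 * Real.sin t * Real.cos t) →
      b * (1 - t ^ 2 / 2) ≤ m * t := by
    intro t ht0 ht1 ht
    have hs : 0 < Real.sin t := Real.sin_pos_of_pos_of_lt_pi ht0 (by linarith [Real.pi_gt_three])
    have hs' : Real.sin t ≤ t := Real.sin_le ht0.le
    have hc : 1 - t ^ 2 / 2 ≤ Real.cos t := Real.one_sub_sq_div_two_le_cos
    have h3 : b * Real.cos t ≤ m * Real.sin t := by
      by_contra h4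
      push Not at h4
      nlinarith
    nlinarith
  have h3 : b * (1 - |y| ^ 2 / 2) ≤ m * |y| := by
    rcases le_total 0 y with hs | hs
    · rw [abs_of_nonneg hs] at hy0 hy1 ⊢
      exact key y hy0 hy1 (by linarith)
    · rw [abs_of_nonpos hs] at hy0 hy1 ⊢
      exact key (-y) hy0 hy1 (by rw [Real.sin_neg, Real.cos_neg]; linarith)
  have h4 : b * (|y| ^ 2 / 2) < 1 / (100 * k) := by
    rw [lt_div_iff₀ (by positivity)]
    nlinarith [sq_nonneg |y|]
  linarith

/-- For S = m sin|y| the hypothesis is a quadratic inequality that is a slight perturbation of S(S -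
b) ≤ 0, whence S ≤ b + 1/(10k). The constant 2000 keeps the perturbation small against (1/(10k))².
Passing from sin|y| to |y| costs a cubic term. -/
theorem exists_pi_mul_le {θ : ℝ} {k m : ℕ} (hk : 0 < k) (hm : 100 * k ≤ m) {b b' : ℝ}
    (hb5 : b ≤ 5) (hb' : |b'| ≤ b)
    (h : (1 - 1 / (2000 * k ^ 2)) * m * (1 - Real.cos (m * (2 * Real.pi * θ)))
      - b' * Real.sin (m * (2 * Real.pi * θ)) ≤ 1 / (2000 * k ^ 2) / m) :
    ∃ r : ℤ, Real.pi * (m * |m * θ - r|) ≤ b + 15 / (100 * k) := by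
  have hkR : (1 : ℝ) ≤ k := by exact_mod_cast hk
  have hmR : 100 * (k : ℝ) ≤ m := by exact_mod_cast hm
  have hm0 : (0 : ℝ) < m := by linarith
  refine ⟨round (m * θ), ?_⟩
  have hround := abs_sub_round ((m : ℝ) * θ)
  set r := round ((m : ℝ) * θ)
  rw [(cos_sin_eq_of_sub_int θ m r).1, (cos_sin_eq_of_sub_int θ m r).2] at h
  set y := Real.pi * (m * θ - r) with hy
  have hyabs : Real.pi * (m * |m * θ - r|) = m * |y| := by
    rw [hy, abs_mul, abs_of_pos Real.pi_pos]; ring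
  have hyle : |y| ≤ Real.pi / 2 := by
    rw [hy, abs_mul, abs_of_pos Real.pi_pos]
    nlinarith [Real.pi_pos]
  rw [hyabs]
  have hb0 : 0 ≤ b := (abs_nonneg b').trans hb'
  set η : ℝ := 1 / (10 * k) with hη
  have hη0 : 0 < η := by positivity
  have hη1 : η ≤ 1 / 10 := by
    rw [hη]
    exact one_div_le_one_div_of_le (by norm_num) (by linarith)
  have hδ : 1 / (2000 * (k : ℝ) ^ 2) = η ^ 2 / 20 := by rw [hη]; field_simp; norm_num
  rw [hδ] at h
  have hs0 : 0 ≤ Real.sin |y| :=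
    Real.sin_nonneg_of_nonneg_of_le_pi (abs_nonneg y) (by linarith [Real.pi_pos])
  have hsabs : |Real.sin y| = Real.sin |y| := by
    rcases le_total 0 y with hs | hs
    · rw [abs_of_nonneg hs] at hs0 ⊢
      exact abs_of_nonneg hs0
    · rw [abs_of_nonpos hs] at hs0 ⊢
      rw [Real.sin_neg] at hs0 ⊢
      exact abs_of_nonpos (by linarith)
  have hssq : Real.sin y ^ 2 = Real.sin |y| ^ 2 := by rw [← hsabs, sq_abs]
  set s := Real.sin |y|
  have hbs : b' * (2 * Real.sin y * Real.cos y) ≤ 2 * b * s := by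
    calc b' * (2 * Real.sin y * Real.cos y) ≤ |b' * (2 * Real.sin y * Real.cos y)| := le_abs_self _
      _ = 2 * |b'| * s * |Real.cos y| := by
        rw [abs_mul, abs_mul, abs_mul, hsabs]; norm_num; ring
      _ ≤ 2 * b * s * 1 := by
        gcongr
        exact Real.abs_cos_le_one y
      _ = 2 * b * s := by ring
  have hS : (1 - η ^ 2 / 20) * (2 * (m * s) ^ 2) - 2 * b * (m * s) ≤ η ^ 2 / 20 := by
    have h1 : (1 - η ^ 2 / 20) * m * (2 * s ^ 2) - 2 * b * s ≤ η ^ 2 / 20 / m := by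
      rw [hssq] at h
      linarith
    have h2 := mul_le_mul_of_nonneg_left h1 hm0.le
    have h3 : (m : ℝ) * (η ^ 2 / 20 / m) = η ^ 2 / 20 := by field_simp
    rw [h3] at h2
    linarith
  set S := m * s with hSdef
  have hSle : S ≤ b + η := by
    by_contra hcon
    push Not at hcon
    have h0 : η * (b + η) ≤ 1 / 10 * 6 := mul_le_mul hη1 (by linarith) (by linarith) (by norm_num)
    have h0' : η * (η * (b + η)) ≤ η * (1 / 10 * 6) := mul_le_mul_of_nonneg_left h0 hη0.le
    have h1 : 7 / 10 * η ≤ (1 - η ^ 2 / 20) * S - b := by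
      have h3 : (1 - η ^ 2 / 20) * (b + η) ≤ (1 - η ^ 2 / 20) * S :=
        mul_le_mul_of_nonneg_left hcon.le (by nlinarith)
      linarith
    have h2 : η * (7 / 10 * η) ≤ S * ((1 - η ^ 2 / 20) * S - b) :=
      mul_le_mul (by linarith) h1 (by positivity) (by linarith)
    have h4 := mul_pos hη0 hη0
    linarith
  -- Jordan's inequality gives a crude bound for m|y|, needed to make the cubic error small.
  have hjordan : 2 / Real.pi * |y| ≤ s := Real.mul_le_sin (abs_nonneg y) hyle
  have hy9 : m * |y| ≤ 9 := by
    have h1 : 2 * |y| ≤ s * Real.pi := by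
      rw [div_mul_eq_mul_div, div_le_iff₀ Real.pi_pos] at hjordan
      exact hjordan
    have h2 : s * Real.pi ≤ s * 3.15 := mul_le_mul_of_nonneg_left Real.pi_lt_d2.le hs0
    have h3 := mul_le_mul_of_nonneg_left (h1.trans h2) hm0.le
    have h4 : (m : ℝ) * (s * 3.15) = 3.15 * S := by rw [hSdef]; ring
    rw [h4] at h3
    linarith
  have hcube : |y| ≤ s + |y| ^ 3 / 6 := by
    rcases (abs_nonneg y).eq_or_lt with h0 | h0
    · rw [← h0]
      linarith
    · have := Real.sin_gt_sub_cube h0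
      linarith
  have hfin : m * (|y| ^ 3 / 6) ≤ 5 / (100 * k) := by
    rw [le_div_iff₀ (by positivity)]
    have h1 : (100 * k) * |y| ≤ 9 := by nlinarith [abs_nonneg y]
    have h2 : |y| ≤ 9 / 100 := by nlinarith [abs_nonneg y]
    have h3 : (m * |y|) * (100 * k * |y|) ≤ 9 * 9 :=
      mul_le_mul hy9 h1 (by positivity) (by norm_num)
    have h4 : (m * |y|) * (100 * k * |y|) * |y| ≤ 9 * 9 * (9 / 100) :=
      mul_le_mul h3 h2 (abs_nonneg y) (by norm_num)
    have h5 : (m : ℝ) * (|y| ^ 3 / 6) * (100 * k) = (m * |y|) * (100 * k * |y|) * |y| / 6 := by ring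
    rw [h5]
    linarith
  have hηk : η = 10 / (100 * k) := by rw [hη]; field_simp; norm_num
  have : (15 : ℝ) / (100 * k) = 10 / (100 * k) + 5 / (100 * k) := by ring
  have hlast := mul_le_mul_of_nonneg_left hcube hm0.le
  rw [mul_add, ← hSdef] at hlast
  linarith

/-! ### Bounds for the two constants -/

theorem abs_sub_div_lt_iff {x c : ℝ} {n m : ℤ} (hm : m ≠ 0) :
    |x - (n : ℝ) / (m : ℝ)| < c / (m : ℝ) ^ 2 ↔ |(m : ℝ)| * |m * x - n| < c := by
  have hm' : (m : ℝ) ≠ 0 := by exact_mod_cast hm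
  have h1 : x - (n : ℝ) / m = (m * x - n) / m := by field_simp
  have h2 : 0 < |(m : ℝ)| := abs_pos.2 hm'
  rw [h1, abs_div, ← sq_abs, lt_div_iff₀ (by positivity)]
  have h3 : |m * x - n| / |(m : ℝ)| * |(m : ℝ)| ^ 2 = |(m : ℝ)| * |m * x - n| := by field_simp
  rw [h3]

/-- Signs do not matter for the quality of an approximation. -/
theorem exists_natAbs_mul_abs (x : ℝ) (m n : ℤ) :
    ∃ r : ℤ, (m.natAbs : ℝ) * |m.natAbs * |x| - r| = |(m : ℝ)| * |m * x - n| := by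
  have hm : ((m.natAbs : ℕ) : ℝ) = |(m : ℝ)| := by
    rw [← Int.cast_natCast, Int.natCast_natAbs, Int.cast_abs]
  rw [hm]
  rcases abs_choice (m : ℝ) with h1 | h1 <;> rcases abs_choice x with h2 | h2
  · exact ⟨n, by rw [h2, h1]⟩
  · refine ⟨-n, ?_⟩
    rw [h2, h1, ← abs_neg (m * x - n)]
    push_cast
    ring_nf
  · refine ⟨-n, ?_⟩
    rw [h2, h1, ← abs_neg (m * x - n)]
    push_cast
    ring_nf
  · refine ⟨n, ?_⟩
    rw [h2, h1]
    ring_nf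

theorem exists_int_of_natCast (x : ℝ) (m : ℕ) (r : ℤ) :
    ∃ n : ℤ, |((m : ℤ) : ℝ)| * |(m : ℤ) * x - n| = (m : ℝ) * |m * |x| - r| := by
  simp only [Int.cast_natCast, Nat.abs_cast]
  rcases abs_choice x with h2 | h2
  · exact ⟨r, by rw [h2]⟩
  · refine ⟨-r, ?_⟩
    rw [h2, ← abs_neg ((m : ℝ) * x - _)]
    push_cast
    ring_nf

/-- Signs of the denominator and of x are irrelevant, so bounds for natural denominators and |x|
sandwich the infimum. The strict inequality in the definition only shifts the admissible c
infinitesimally. -/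
theorem abs_sub_diophantineType_le {x t τ : ℝ}
    (h1 : ∃ m : ℕ, 0 < m ∧ ∃ r : ℤ, (m : ℝ) * |m * |x| - r| ≤ t + τ)
    (h2 : ∀ m : ℕ, 0 < m → ∀ r : ℤ, t - τ ≤ (m : ℝ) * |m * |x| - r|) :
    |t - diophantineType x| ≤ τ := by
  have hlow : ∀ c ∈ {c : ℝ | ∃ n m : ℤ, m ≠ 0 ∧ |x - (n : ℝ) / (m : ℝ)| < c / (m : ℝ) ^ 2},
      t - τ ≤ c := by
    rintro c ⟨n, m, hm, hc⟩
    rw [abs_sub_div_lt_iff hm] at hc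
    obtain ⟨r, hr⟩ := exists_natAbs_mul_abs x m n
    exact ((h2 m.natAbs (Int.natAbs_pos.2 hm) r).trans hr.le).trans hc.le
  have hmem : ∀ c, t + τ < c →
      c ∈ {c : ℝ | ∃ n m : ℤ, m ≠ 0 ∧ |x - (n : ℝ) / (m : ℝ)| < c / (m : ℝ) ^ 2} := by
    intro c hc
    obtain ⟨m, hm, r, hr⟩ := h1
    obtain ⟨n, hn⟩ := exists_int_of_natCast x m r
    have hm' : (m : ℤ) ≠ 0 := by omega
    refine ⟨n, m, hm', ?_⟩
    rw [abs_sub_div_lt_iff hm', hn]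
    exact hr.trans_lt hc
  have hlo : t - τ ≤ diophantineType x :=
    le_csInf ⟨t + τ + 1, hmem _ (lt_add_one _)⟩ hlow
  have hup : diophantineType x ≤ t + τ :=
    le_of_forall_gt_imp_ge_of_dense fun c hc => csInf_le ⟨t - τ, hlow⟩ (hmem c hc)
  rw [abs_le]
  constructor <;> linarith

theorem abs_sub_lagrangeConstant_le {x t τ : ℝ}
    (h1 : ∃ᶠ m : ℕ in Filter.atTop, ∃ r : ℤ, (m : ℝ) * |m * |x| - r| ≤ t + τ)
    (h2 : ∀ᶠ m : ℕ in Filter.atTop, ∀ r : ℤ, t - τ ≤ (m : ℝ) * |m * |x| - r|) :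
    |t - lagrangeConstant x| ≤ τ := by
  have hlow : ∀ c ∈ {c : ℝ | {s : ℤ × ℤ | s.2 ≠ 0 ∧
      |x - (s.1 : ℝ) / (s.2 : ℝ)| < c / (s.2 : ℝ) ^ 2}.Infinite}, t - τ ≤ c := by
    intro c hc
    by_contra hcon
    push Not at hcon
    obtain ⟨M, hM⟩ := Filter.eventually_atTop.1 h2
    -- If c < t - τ, all admissible denominators are below M, and then the numerators are bounded by
    -- M|x| + |c|: only finitely many pairs remain.
    obtain ⟨K, hK⟩ := exists_nat_ge (M * |x| + |c|)
    refine hc (((Set.finite_Icc (-(K : ℤ)) K).prod (Set.finite_Icc (-(M : ℤ)) M)).subset ?_)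
    rintro ⟨n, m⟩ ⟨hm, hlt⟩
    simp only at hm hlt
    rw [abs_sub_div_lt_iff hm] at hlt
    obtain ⟨r, hr⟩ := exists_natAbs_mul_abs x m n
    have hmM : m.natAbs < M := by
      by_contra hge
      have := hM m.natAbs (not_lt.1 hge) r
      linarith
    have hm1 : (1 : ℝ) ≤ |(m : ℝ)| := by
      have : (1 : ℤ) ≤ |m| := Int.one_le_abs hm
      exact_mod_cast this
    have hmM' : |(m : ℝ)| ≤ M := by
      have : |m| ≤ (M : ℤ) := by rw [← Int.natCast_natAbs]; exact_mod_cast hmM.le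
      exact_mod_cast this
    have hnK : |(n : ℝ)| ≤ K := by
      have e1 : |m * x - n| ≤ |c| := by
        have := le_abs_self c
        nlinarith [abs_nonneg (m * x - n)]
      have e2 : |(n : ℝ)| ≤ |m * x - n| + |m * x| := by
        have := abs_sub_abs_le_abs_sub (n : ℝ) (m * x)
        rw [abs_sub_comm] at this
        linarith
      have e3 : |m * x| ≤ M * |x| := by
        rw [abs_mul]
        exact mul_le_mul_of_nonneg_right hmM' (abs_nonneg x)
      linarith
    have hnK' : |n| ≤ (K : ℤ) := by exact_mod_cast hnK
    exact ⟨abs_le.1 hnK', ⟨by omega, by omega⟩⟩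
  have hmem : ∀ c, t + τ < c → c ∈ {c : ℝ | {s : ℤ × ℤ | s.2 ≠ 0 ∧
      |x - (s.1 : ℝ) / (s.2 : ℝ)| < c / (s.2 : ℝ) ^ 2}.Infinite} := by
    intro c hc
    have h3 := Nat.frequently_atTop_iff_infinite.1 (h1.and_eventually (Filter.eventually_gt_atTop 0))
    refine Set.Infinite.of_image (fun s : ℤ × ℤ => s.2.natAbs) (h3.mono ?_)
    rintro m ⟨⟨r, hr⟩, hm⟩
    obtain ⟨n, hn⟩ := exists_int_of_natCast x m r
    have hm' : (m : ℤ) ≠ 0 := by omega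
    refine ⟨(n, m), ⟨hm', ?_⟩, by simp⟩
    rw [abs_sub_div_lt_iff hm', hn]
    exact hr.trans_lt hc
  have hlo : t - τ ≤ lagrangeConstant x :=
    le_csInf ⟨t + τ + 1, hmem _ (lt_add_one _)⟩ hlow
  have hup : lagrangeConstant x ≤ t + τ :=
    le_of_forall_gt_imp_ge_of_dense fun c hc => csInf_le ⟨t - τ, hlow⟩ (hmem c hc)
  rw [abs_le]
  constructor <;> linarith

/-- Dirichlet's theorem: infinitely many denominators give good approximations. -/
theorem frequently_mul_abs_lt_one {θ : ℝ} (hθ : Irrational θ) :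
    ∃ᶠ m : ℕ in Filter.atTop, ∃ r : ℤ, (m : ℝ) * |m * θ - r| < 1 := by
  rw [Filter.frequently_atTop]
  intro M
  by_contra hcon
  push Not at hcon
  -- Bounded denominators force bounded numerators, contradicting the infinitude of good rational
  -- approximations.
  obtain ⟨K, hK⟩ := exists_nat_ge (M * |θ| + 1)
  refine Real.infinite_rat_abs_sub_lt_one_div_den_sq_of_irrational hθ
    ((((Set.finite_Icc (-(K : ℤ)) K).prod (Set.finite_Icc 0 M)).image
      fun s : ℤ × ℕ => (s.1 : ℚ) / s.2).subset ?_)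
  intro w hw
  have hd : (0 : ℝ) < w.den := by exact_mod_cast w.pos
  have hd1 : (1 : ℝ) ≤ w.den := by exact_mod_cast w.pos
  have hlt : (w.den : ℝ) * |w.den * θ - w.num| < 1 := by
    have h0 : |θ - (w.num : ℝ) / ((w.den : ℤ) : ℝ)| < 1 / ((w.den : ℤ) : ℝ) ^ 2 := by
      have : ((w : ℚ) : ℝ) = (w.num : ℝ) / ((w.den : ℤ) : ℝ) := by
        rw [Int.cast_natCast]; exact Rat.cast_def w
      rw [← this, Int.cast_natCast]
      exact hw
    rw [abs_sub_div_lt_iff (by exact_mod_cast w.den_nz)] at h0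
    simpa using h0
  have hM : w.den < M := by
    by_contra hge
    have := hcon w.den (not_lt.1 hge) w.num
    linarith
  have hMR : (w.den : ℝ) ≤ M := by exact_mod_cast hM.le
  have hnK : |(w.num : ℝ)| ≤ K := by
    have e1 : |w.den * θ - w.num| ≤ 1 := by nlinarith [abs_nonneg (w.den * θ - w.num)]
    have e2 : |(w.num : ℝ)| ≤ |w.den * θ - w.num| + |w.den * θ| := by
      have := abs_sub_abs_le_abs_sub (w.num : ℝ) (w.den * θ)
      rw [abs_sub_comm] at this
      linarith
    have e3 : |w.den * θ| ≤ M * |θ| := by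
      rw [abs_mul, abs_of_pos hd]
      exact mul_le_mul_of_nonneg_right hMR (abs_nonneg θ)
    linarith
  have hnK' : |w.num| ≤ (K : ℤ) := by exact_mod_cast hnK
  exact ⟨(w.num, w.den), ⟨abs_le.1 hnK', ⟨Nat.zero_le _, hM.le⟩⟩, Rat.num_div_den w⟩

end RobustLRS


namespace RobustLRS

/-! ### Data computed from the input -/

/-- Inputs: codes of `cos 2πθ` and of the precision. -/
abbrev ApproxInput : Type := RatCode × RatCode

/-- Powers of a Gaussian integer. -/
def gaussPow (z : ℤ × ℤ) : ℕ → ℤ × ℤ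
  | 0 => (1, 0)
  | m + 1 => (z.1 * (gaussPow z m).1 - z.2 * (gaussPow z m).2,
      z.2 * (gaussPow z m).1 + z.1 * (gaussPow z m).2)

theorem primrec_gaussPow : Primrec₂ gaussPow := by
  have h : Primrec₂ fun (z : ℤ × ℤ) (w : ℕ × (ℤ × ℤ)) =>
      (z.1 * w.2.1 - z.2 * w.2.2, z.2 * w.2.1 + z.1 * w.2.2) := by
    have z1 : Primrec fun y : (ℤ × ℤ) × (ℕ × (ℤ × ℤ)) => y.1.1 := Primrec.fst.comp Primrec.fst
    have z2 : Primrec fun y : (ℤ × ℤ) × (ℕ × (ℤ × ℤ)) => y.1.2 := Primrec.snd.comp Primrec.fst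
    have w1 : Primrec fun y : (ℤ × ℤ) × (ℕ × (ℤ × ℤ)) => y.2.2.1 :=
      Primrec.fst.comp (Primrec.snd.comp Primrec.snd)
    have w2 : Primrec fun y : (ℤ × ℤ) × (ℕ × (ℤ × ℤ)) => y.2.2.2 :=
      Primrec.snd.comp (Primrec.snd.comp Primrec.snd)
    exact Primrec.pair
      (primrec_int_sub.comp (primrec_int_mul.comp z1 w1) (primrec_int_mul.comp z2 w2))
      (primrec_int_add.comp (primrec_int_mul.comp z2 w1) (primrec_int_mul.comp z1 w2))
  refine (Primrec.nat_rec (Primrec.const ((1, 0) : ℤ × ℤ)) h).of_eq fun z m => ?_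
  induction m with
  | zero => rfl
  | succ m ih => simp only [gaussPow, ← ih]

/-- With the common denominator d^m the powers are computed by a recursion on integers, and their
signs are decided exactly. -/
theorem rot_div_eq_gaussPow (z : ℤ × ℤ) {d : ℕ} (hd : 0 < d) (m : ℕ) :
    (rot (z.1 / d) (z.2 / d) m).1 = ((gaussPow z m).1 : ℚ) / (d : ℚ) ^ m ∧
      (rot (z.1 / d) (z.2 / d) m).2 = ((gaussPow z m).2 : ℚ) / (d : ℚ) ^ m := by
  have hd' : (d : ℚ) ≠ 0 := by positivity
  induction m with
  | zero => simp [rot, gaussPow]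
  | succ m ih =>
    simp only [rot, gaussPow]
    rw [ih.1, ih.2, pow_succ]
    push_cast
    constructor <;> field_simp

/-- The denominator of `cos 2πθ`. -/
def den (x : ApproxInput) : ℕ := x.1.2 + 1

/-- The numerator of `sin 2π|θ|`. -/
def sinNum (x : ApproxInput) : ℕ :=
  Nat.sqrt (den x * den x - (x.1.1.toNat + (-x.1.1).toNat) * (x.1.1.toNat + (-x.1.1).toNat))

/-- The point `exp (2πi|θ|)`, multiplied by `den`. -/
def point (x : ApproxInput) : ℤ × ℤ := (x.1.1, (sinNum x : ℤ))

/-- The number `cos 2πθ`. -/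
def cosOf (x : ApproxInput) : ℚ := (point x).1 / (den x : ℕ)

/-- The number `sin 2π|θ|`. -/
def sinOf (x : ApproxInput) : ℚ := (point x).2 / (den x : ℕ)

/-- The reciprocal of the precision. -/
def prec (x : ApproxInput) : ℕ := x.2.2 + 1

/-- The first index considered in the recurrence. -/
def start (x : ApproxInput) : ℕ := 100 * prec x

theorem primrec_den : Primrec den := Primrec.succ.comp (Primrec.snd.comp Primrec.fst)

theorem primrec_prec : Primrec prec := Primrec.succ.comp (Primrec.snd.comp Primrec.snd)

theorem primrec_start : Primrec start := Primrec.nat_mul.comp (Primrec.const 100) primrec_prec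

theorem primrec_point : Primrec point := by
  have h1 : Primrec fun x : ApproxInput => x.1.1 := Primrec.fst.comp Primrec.fst
  have h2 : Primrec fun x : ApproxInput => x.1.1.toNat + (-x.1.1).toNat :=
    Primrec.nat_add.comp (primrec_int_toNat.comp h1) (primrec_int_neg_toNat.comp h1)
  exact Primrec.pair h1 (primrec_int_natCast.comp (Primrec.nat_sqrt.comp
    (Primrec.nat_sub.comp (Primrec.nat_mul.comp primrec_den primrec_den)
      (Primrec.nat_mul.comp h2 h2))))

theorem primrec_nat_pow : Primrec₂ fun a b : ℕ => a ^ b :=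
  Primrec₂.unpaired'.1 Nat.Primrec.pow

/-! ### Primitive recursive computation of the queries -/

section PrimrecRat

open PrimrecRat

theorem den_pos (x : ApproxInput) : 0 < den x := Nat.succ_pos _

theorem prec_pos (x : ApproxInput) : 0 < prec x := Nat.succ_pos _

theorem primrecRat_rot {f : ApproxInput → ℕ} (hf : Primrec f) :
    (PrimrecRat fun x => (rot (cosOf x) (sinOf x) (f x)).1) ∧
      PrimrecRat fun x => (rot (cosOf x) (sinOf x) (f x)).2 := by
  have hg := primrec_gaussPow.comp primrec_point hf
  have hd := PrimrecRat.natCast (primrec_nat_pow.comp primrec_den hf)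
  constructor
  · refine ((intCast (Primrec.fst.comp hg)).div hd).of_eq fun x => ?_
    rw [cosOf, sinOf, (rot_div_eq_gaussPow (point x) (den_pos x) (f x)).1]
    push_cast
    rfl
  · refine ((intCast (Primrec.snd.comp hg)).div hd).of_eq fun x => ?_
    rw [cosOf, sinOf, (rot_div_eq_gaussPow (point x) (den_pos x) (f x)).2]
    push_cast
    rfl

theorem primrec_start_add (j : ℕ) : Primrec fun x => start x + j :=
  Primrec.nat_add.comp primrec_start (Primrec.const j)

theorem primrecRat_basicSol {f : ApproxInput → ℕ} (hf : Primrec f) (l : Fin 6) :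
    PrimrecRat fun x => basicSol (cosOf x) (sinOf x) (f x) l := by
  obtain ⟨h1, h2⟩ := primrecRat_rot hf
  have h0 := natCast hf
  fin_cases l
  · exact h0
  · exact h0.mul h1
  · exact h0.mul h2
  · exact const 1
  · exact h1
  · exact h2

theorem primrecRat_casorati_inv (i l : Fin 6) :
    PrimrecRat fun x => (casorati (cosOf x) (sinOf x) (start x))⁻¹ i l :=
  matrix_inv (A := fun x => casorati (cosOf x) (sinOf x) (start x))
    (fun a b => primrecRat_basicSol (primrec_start_add (b : ℕ)) a) i l

theorem primrecRat_growth (i : Fin 6) :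
    PrimrecRat fun x => growth (cosOf x) (sinOf x) (start x) i :=
  (primrecRat_casorati_inv i 0).add (primrecRat_casorati_inv i 1)

theorem primrecRat_growthSq : PrimrecRat fun x => growthSq (cosOf x) (sinOf x) (start x) :=
  sum _ fun i _ => (((primrecRat_growth i).mul (primrecRat_growth i)).of_eq fun _ => (sq _).symm)

theorem primrecRat_invSize : PrimrecRat fun x => invSize (cosOf x) (sinOf x) (start x) :=
  sum _ fun i _ => sum _ fun l _ =>
    (((primrecRat_casorati_inv i l).mul (primrecRat_casorati_inv i l)).of_eq fun _ => (sq _).symm)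

theorem primrecRat_coeffs (j : Fin 6) : PrimrecRat fun x => coeffs (cosOf x) j := by
  have hp : PrimrecRat cosOf :=
    (intCast (Primrec.fst.comp primrec_point)).div (natCast primrec_den)
  have h1 : PrimrecRat fun x => 4 * cosOf x + 2 := ((const 4).mul hp).add (const 2)
  have h2 : PrimrecRat fun x => cosOf x ^ 2 := (hp.mul hp).of_eq fun _ => (sq _).symm
  have h3 : PrimrecRat fun x => -(4 * cosOf x ^ 2 + 8 * cosOf x + 3) :=
    ((((const 4).mul h2).add ((const 8).mul hp)).add (const 3)).neg
  have h4 : PrimrecRat fun x => 8 * cosOf x ^ 2 + 8 * cosOf x + 4 :=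
    (((const 8).mul h2).add ((const 8).mul hp)).add (const 4)
  fin_cases j
  exacts [const (-1), h1, h3, h4, h3, h1]

/-- The radius of the balls is the reciprocal of a large natural number. -/
theorem exists_radius : ∃ R : ApproxInput → ℕ, Primrec R ∧ ∀ x, 4 * prec x ≤ R x ∧
    8 * invSize (cosOf x) (sinOf x) (start x) *
      (1 + 1 / growthSq (cosOf x) (sinOf x) (start x)) * (2000 * prec x ^ 2) ≤ R x := by
  have h : PrimrecRat fun x => 8 * invSize (cosOf x) (sinOf x) (start x) *
      (1 + 1 / growthSq (cosOf x) (sinOf x) (start x)) * (2000 * prec x ^ 2) :=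
    (((const 8).mul primrecRat_invSize).mul
      ((const 1).add ((const 1).div primrecRat_growthSq))).mul
        ((const 2000).mul (((natCast primrec_prec).mul (natCast primrec_prec)).of_eq
          fun _ => (sq _).symm))
  obtain ⟨f, hf, hfF⟩ := h.exists_nat_ge
  -- The first summand makes the grid step 1/(3R) at most 1/(12 prec); the second brings the
  -- constant of `small_of_inner_centre_le` below 1/(2000 prec²) for the radius 1/R.
  refine ⟨fun x => 4 * prec x + f x,
    Primrec.nat_add.comp (Primrec.nat_mul.comp (Primrec.const 4) primrec_prec) hf, fun x =>
      ⟨Nat.le_add_right _ _, (hfF x).trans ?_⟩⟩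
  push_cast
  have : (0 : ℚ) ≤ 4 * prec x := by positivity
  linarith

/-- The sign of the parameter in the `j`-th query. -/
def querySign (j : ℕ) : ℚ := if j % 2 = 0 then 1 else -1

theorem abs_querySign (j : ℕ) : |querySign j| = 1 := by
  unfold querySign
  split_ifs <;> simp

theorem primrecRat_comp_fst {F : ApproxInput → ℚ} (hF : PrimrecRat F) :
    PrimrecRat fun y : ApproxInput × ℕ => F y.1 := hF.comp Primrec.fst

/-- The inputs of the oracle can be computed. -/
theorem exists_query {R : ApproxInput → ℕ} (hR : Primrec R) :
    ∃ f : ApproxInput × ℕ → BallInput 6, Primrec f ∧ ∀ x j, 0 < R x →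
      cosOf x ^ 2 + sinOf x ^ 2 = 1 → sinOf x ≠ 0 →
      Describes (f (x, j)) (coeffs (cosOf x))
        (centre (cosOf x) (sinOf x) (start x)
          (querySign j * ((j / 2 : ℕ) * (1 / (3 * R x)))) (1 / R x)) (1 / R x) := by
  choose fa hfa hfa' using fun j => primrecRat_comp_fst (primrecRat_coeffs j)
  have hRr : PrimrecRat fun y : ApproxInput × ℕ => (R y.1 : ℚ) :=
    primrecRat_comp_fst (natCast hR)
  have hρ : PrimrecRat fun y : ApproxInput × ℕ => 1 / (R y.1 : ℚ) := (const 1).div hRr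
  obtain ⟨fρ, hfρ, hfρ'⟩ := hρ
  have hsign : PrimrecRat fun y : ApproxInput × ℕ => querySign y.2 :=
    ite (Primrec.eq.comp (Primrec.nat_mod.comp Primrec.snd (Primrec.const 2)) (Primrec.const 0))
      (const 1) (const (-1))
  have hb : PrimrecRat fun y : ApproxInput × ℕ =>
      querySign y.2 * ((y.2 / 2 : ℕ) * (1 / (3 * (R y.1 : ℚ)))) :=
    hsign.mul ((natCast (Primrec.nat_div.comp Primrec.snd (Primrec.const 2))).mul
      ((const 1).div ((const 3).mul hRr)))
  -- The rational part of the entries of the centre and, next, the coefficient of the square root,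
  -- as in `centre_apply`.
  have hα : ∀ j : Fin 6, PrimrecRat fun y : ApproxInput × ℕ =>
      tangentInit (cosOf y.1) (sinOf y.1) (start y.1)
        (querySign y.2 * ((y.2 / 2 : ℕ) * (1 / (3 * (R y.1 : ℚ))))) j := fun j => by
    have h1 := primrecRat_rot (primrec_start_add j)
    exact ((primrecRat_comp_fst (natCast (primrec_start_add j))).mul
      ((const 1).sub (primrecRat_comp_fst h1.1))).sub (hb.mul (primrecRat_comp_fst h1.2))
  have hβ : ∀ j : Fin 6, PrimrecRat fun y : ApproxInput × ℕ =>
      1 / (R y.1 : ℚ) * growth (cosOf y.1) (sinOf y.1) (start y.1) j /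
        growthSq (cosOf y.1) (sinOf y.1) (start y.1) := fun j =>
    (((const 1).div hRr).mul (primrecRat_comp_fst (primrecRat_growth j))).div
      (primrecRat_comp_fst primrecRat_growthSq)
  choose fc hfc hfc' using fun j =>
    exists_algCode (hα j) (hβ j) (primrecRat_comp_fst primrecRat_growthSq)
  refine ⟨fun y => (fun j => fa j y, fun j => fc j y, fρ y),
    Primrec.pair (Primrec.fin_curry.2 (Primrec.fin_curry₁.2 hfa).swap)
      (Primrec.pair (Primrec.fin_curry.2 (Primrec.fin_curry₁.2 hfc).swap) hfρ),
    fun x j hRx h hq => ⟨fun i => hfa' i (x, j), fun i => ?_, hfρ' (x, j), ?_, ?_⟩⟩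
  · rw [centre_apply h hq]
    exact hfc' i (x, j) (growthSq_pos h hq _)
  · simp [coeffs]
  · have : (0 : ℚ) < R x := by exact_mod_cast hRx
    positivity

end PrimrecRat

end RobustLRS


namespace RobustLRS

/-! ### Numerical approximation of angles -/

/-- The condition that the angle is in the half-open upper half turn. -/
def upperHalf (z : ℤ × ℤ) : Bool := decide (0 < z.2) || (decide (z.2 = 0) && decide (0 < z.1))

/-- The number of changes between the upper and the lower half plane among the first powers. -/
def halfTurns (z : ℤ × ℤ) : ℕ → ℕ
  | 0 => 0
  | m + 1 => halfTurns z m +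
      if upperHalf (gaussPow z m) = upperHalf (gaussPow z (m + 1)) then 0 else 1

theorem primrec_upperHalf : Primrec upperHalf := by
  have h1 : Primrec fun z : ℤ × ℤ => decide (0 < z.2) :=
    (primrec_int_pos.comp Primrec.snd).decide
  have h2 : Primrec fun z : ℤ × ℤ => decide (z.2 = 0) :=
    (primrec_int_eq_zero.comp Primrec.snd).decide
  have h3 : Primrec fun z : ℤ × ℤ => decide (0 < z.1) :=
    (primrec_int_pos.comp Primrec.fst).decide
  exact Primrec.or.comp h1 (Primrec.and.comp h2 h3)

theorem primrec_halfTurns : Primrec₂ halfTurns := by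
  have h : Primrec₂ fun (z : ℤ × ℤ) (w : ℕ × ℕ) =>
      w.2 + if upperHalf (gaussPow z w.1) = upperHalf (gaussPow z (w.1 + 1)) then 0 else 1 := by
    have z1 : Primrec fun y : (ℤ × ℤ) × (ℕ × ℕ) => y.2.1 := Primrec.fst.comp Primrec.snd
    have u1 := primrec_upperHalf.comp (primrec_gaussPow.comp Primrec.fst z1)
    have u2 := primrec_upperHalf.comp (primrec_gaussPow.comp Primrec.fst (Primrec.succ.comp z1))
    exact Primrec.nat_add.comp (Primrec.snd.comp Primrec.snd)
      (Primrec.ite (Primrec.eq.comp u1 u2) (Primrec.const 0) (Primrec.const 1))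
  refine (Primrec.nat_rec (Primrec.const 0) h).of_eq fun z m => ?_
  induction m with
  | zero => rfl
  | succ m ih => simp only [halfTurns, ← ih]

/-- The half-open upper half turn, including angle 0 and excluding π, is exactly the set of angles
πx for which the floor of x is even. -/
theorem even_iff_of_floor {x : ℝ} {c : ℕ} (h1 : (c : ℝ) ≤ x) (h2 : x < c + 1) :
    (0 < Real.sin (Real.pi * x) ∨ (Real.sin (Real.pi * x) = 0 ∧ 0 < Real.cos (Real.pi * x)))
      ↔ Even c := by
  obtain ⟨y, rfl⟩ : ∃ y, x = c + y := ⟨x - c, by ring⟩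
  have hy0 : 0 ≤ y := by linarith
  have hy1 : y < 1 := by linarith
  have hs : 0 ≤ Real.sin (Real.pi * y) :=
    Real.sin_nonneg_of_nonneg_of_le_pi (by positivity) (by nlinarith [Real.pi_pos])
  have hz : Real.sin (Real.pi * y) = 0 → Real.cos (Real.pi * y) = 1 := by
    intro h
    rcases hy0.eq_or_lt with rfl | hpos
    · simp
    · have := Real.sin_pos_of_pos_of_lt_pi (mul_pos Real.pi_pos hpos)
        (by nlinarith [Real.pi_pos])
      linarith
  rcases Nat.even_or_odd c with hc | hc
  · refine iff_of_true ?_ hc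
    obtain ⟨e, rfl⟩ := hc
    have he : Real.pi * (((e + e : ℕ) : ℝ) + y) = Real.pi * y + e * (2 * Real.pi) := by
      push_cast; ring
    rw [he, Real.sin_add_nat_mul_two_pi, Real.cos_add_nat_mul_two_pi]
    rcases hs.eq_or_lt with h | h
    · exact Or.inr ⟨h.symm, by rw [hz h.symm]; exact one_pos⟩
    · exact Or.inl h
  · refine iff_of_false ?_ (Nat.not_even_iff_odd.2 hc)
    obtain ⟨e, rfl⟩ := hc
    have he : Real.pi * (((2 * e + 1 : ℕ) : ℝ) + y)
        = Real.pi * y + Real.pi + e * (2 * Real.pi) := by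
      push_cast; ring
    rw [he, Real.sin_add_nat_mul_two_pi, Real.cos_add_nat_mul_two_pi, Real.sin_add_pi,
      Real.cos_add_pi]
    rintro (h | ⟨h, h'⟩)
    · linarith
    · rw [hz (by linarith)] at h'
      linarith

theorem upperHalf_gaussPow {z : ℤ × ℤ} {d : ℕ} (hd : 0 < d) {θ : ℝ}
    (h1 : ((z.1 : ℚ) / d : ℚ) = Real.cos (2 * Real.pi * θ))
    (h2 : ((z.2 : ℚ) / d : ℚ) = Real.sin (2 * Real.pi * θ)) (m : ℕ) :
    upperHalf (gaussPow z m) = true ↔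
      (0 < Real.sin (Real.pi * (2 * m * θ)) ∨
        (Real.sin (Real.pi * (2 * m * θ)) = 0 ∧ 0 < Real.cos (Real.pi * (2 * m * θ)))) := by
  have e1 := rot_eq_cos_sin h1 h2 m
  have e2 := rot_div_eq_gaussPow z hd m
  rw [e2.1, e2.2] at e1
  push_cast at e1
  have ha : Real.pi * (2 * m * θ) = m * (2 * Real.pi * θ) := by ring
  have hdm : (0 : ℝ) < (d : ℝ) ^ m := by positivity
  rw [ha, ← e1.1, ← e1.2, div_pos_iff_of_pos_right hdm, div_pos_iff_of_pos_right hdm,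
    div_eq_zero_iff]
  simp [upperHalf, hdm.ne']

/-- Since 0 < 2θ < 1, the floor of 2mθ grows by 0 or 1 at each step. Its parity is visible from the
half plane, so the changes of half plane count the growth exactly. -/
theorem halfTurns_le {z : ℤ × ℤ} {d : ℕ} (hd : 0 < d) {θ : ℝ} (hθ0 : 0 < θ) (hθ1 : θ < 1 / 2)
    (h1 : ((z.1 : ℚ) / d : ℚ) = Real.cos (2 * Real.pi * θ))
    (h2 : ((z.2 : ℚ) / d : ℚ) = Real.sin (2 * Real.pi * θ)) (m : ℕ) :
    (halfTurns z m : ℝ) ≤ 2 * m * θ ∧ 2 * m * θ < halfTurns z m + 1 := by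
  induction m with
  | zero => simp [halfTurns]
  | succ m ih =>
    have hm := (upperHalf_gaussPow hd h1 h2 m).trans (even_iff_of_floor ih.1 ih.2)
    have hm1 := upperHalf_gaussPow hd h1 h2 (m + 1)
    push_cast at hm1 ⊢
    by_cases hlt : 2 * ((m : ℝ) + 1) * θ < halfTurns z m + 1
    · have hle : (halfTurns z m : ℝ) ≤ 2 * ((m : ℝ) + 1) * θ := by nlinarith
      have he := hm1.trans (even_iff_of_floor hle hlt)
      have : upperHalf (gaussPow z m) = upperHalf (gaussPow z (m + 1)) :=
        Bool.eq_iff_iff.2 (hm.trans he.symm)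
      rw [halfTurns, if_pos this, add_zero]
      exact ⟨hle, hlt⟩
    · have hle : ((halfTurns z m + 1 : ℕ) : ℝ) ≤ 2 * ((m : ℝ) + 1) * θ := by
        push_cast; exact not_lt.1 hlt
      have hlt' : 2 * ((m : ℝ) + 1) * θ < ((halfTurns z m + 1 : ℕ) : ℝ) + 1 := by
        push_cast; nlinarith
      have he := hm1.trans (even_iff_of_floor hle hlt')
      have : ¬ upperHalf (gaussPow z m) = upperHalf (gaussPow z (m + 1)) := by
        intro e
        rw [← e, hm, Nat.even_add_one] at he
        exact absurd he (by tauto)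
      rw [halfTurns, if_neg this]
      exact ⟨hle, hlt'⟩

/-! ### The quality of the first approximations -/

/-- The number `m * ‖m * c / n‖`, multiplied by `n`. -/
def scaledQuality (c n m : ℕ) : ℕ := m * min (m * c % n) (n - m * c % n)

/-- The least of the first values of `scaledQuality`. -/
def minQuality (c n : ℕ) : ℕ → ℕ
  | 0 => scaledQuality c n 1
  | i + 1 => min (minQuality c n i) (scaledQuality c n (i + 2))

theorem primrec_minQuality :
    Primrec fun y : (ℕ × ℕ) × ℕ => minQuality y.1.1 y.1.2 y.2 := by
  have hs : Primrec fun y : (ℕ × ℕ) × ℕ => scaledQuality y.1.1 y.1.2 y.2 := by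
    have hc : Primrec fun y : (ℕ × ℕ) × ℕ => y.1.1 := Primrec.fst.comp Primrec.fst
    have hn : Primrec fun y : (ℕ × ℕ) × ℕ => y.1.2 := Primrec.snd.comp Primrec.fst
    have hm : Primrec fun y : (ℕ × ℕ) × ℕ => y.2 := Primrec.snd
    have hr := Primrec.nat_mod.comp (Primrec.nat_mul.comp hm hc) hn
    exact Primrec.nat_mul.comp hm (Primrec.nat_min.comp hr (Primrec.nat_sub.comp hn hr))
  have h : Primrec₂ fun (a : ℕ × ℕ) (w : ℕ × ℕ) =>
      min w.2 (scaledQuality a.1 a.2 (w.1 + 2)) := by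
    have z1 : Primrec fun y : (ℕ × ℕ) × (ℕ × ℕ) => y.2.1 + 2 :=
      Primrec.nat_add.comp (Primrec.fst.comp Primrec.snd) (Primrec.const 2)
    exact Primrec.nat_min.comp (Primrec.snd.comp Primrec.snd)
      (hs.comp (Primrec.pair Primrec.fst z1))
  have h0 : Primrec fun a : ℕ × ℕ => scaledQuality a.1 a.2 1 :=
    hs.comp (Primrec.pair Primrec.id (Primrec.const 1))
  refine Primrec.of_eq (Primrec.nat_rec h0 h) ?_
  rintro ⟨a, m⟩
  induction m with
  | zero => rfl
  | succ m ih =>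
    simp only at ih ⊢
    simp only [minQuality, ← ih]

theorem minQuality_spec (c n i : ℕ) :
    (∃ m, 0 < m ∧ m ≤ i + 1 ∧ minQuality c n i = scaledQuality c n m) ∧
      ∀ m, 0 < m → m ≤ i + 1 → minQuality c n i ≤ scaledQuality c n m := by
  induction i with
  | zero =>
    refine ⟨⟨1, one_pos, le_rfl, rfl⟩, fun m h0 h1 => ?_⟩
    obtain rfl : m = 1 := by omega
    rfl
  | succ i ih =>
    obtain ⟨⟨m, hm0, hm1, hm⟩, hall⟩ := ih
    constructor
    · rcases min_choice (minQuality c n i) (scaledQuality c n (i + 2)) with h | h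
      · exact ⟨m, hm0, by omega, by rw [minQuality, h, hm]⟩
      · exact ⟨i + 2, by omega, by omega, by rw [minQuality, h]⟩
    · intro m' h0 h1
      rcases Nat.lt_or_ge m' (i + 2) with h | h
      · exact (min_le_left _ _).trans (hall m' h0 (by omega))
      · obtain rfl : m' = i + 2 := by omega
        exact min_le_right _ _

/-- The residue of mc modulo n, or its complement if smaller, is n times the distance from mc/n to
the nearest integer. -/
theorem scaledQuality_eq (c m n : ℕ) :
    (scaledQuality c n m : ℝ) / n
      = m * |(m * (c / n : ℝ)) - round (m * (c / n : ℝ))| := by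
  have h := abs_sub_round_div_natCast_eq (α := ℝ) (m := m * c) (n := n)
  have e : ((m * c : ℕ) : ℝ) / n = m * (c / n : ℝ) := by push_cast; ring
  rw [e] at h
  rw [h, scaledQuality]
  push_cast
  ring

/-- The best of the first approximations of `θ`, up to an error. -/
theorem minQuality_bounds {θ τ : ℝ} {c n M : ℕ} (hn : 0 < n) (hc : |θ - c / n| ≤ 1 / n)
    (hM : (M : ℝ) ^ 2 / n ≤ τ) (hM2 : 2 ≤ M) :
    (∃ m : ℕ, 0 < m ∧ ∃ r : ℤ,
      (m : ℝ) * |m * θ - r| ≤ (minQuality c n (M - 2) : ℝ) / n + τ) ∧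
    ∀ m : ℕ, 0 < m → m < M → ∀ r : ℤ,
      (minQuality c n (M - 2) : ℝ) / n - τ ≤ (m : ℝ) * |m * θ - r| := by
  have hnR : (0 : ℝ) < n := by exact_mod_cast hn
  -- Replacing θ by c/n moves m · |mθ - r| by at most m²/n.
  have herr : ∀ m : ℕ, m ≤ M → (m : ℝ) * |m * θ - m * (c / n : ℝ)| ≤ τ := by
    intro m hm
    have hmR : (m : ℝ) ≤ M := by exact_mod_cast hm
    rw [← mul_sub, abs_mul, Nat.abs_cast]
    calc (m : ℝ) * (m * |θ - c / n|) ≤ M * (M * (1 / n)) := by gcongr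
      _ = (M : ℝ) ^ 2 / n := by ring
      _ ≤ τ := hM
  -- The index M - 2 stands for the range 1 ≤ m ≤ M - 1.
  obtain ⟨⟨m, hm0, hm1, hm⟩, hall⟩ := minQuality_spec c n (M - 2)
  constructor
  · refine ⟨m, hm0, round (m * (c / n : ℝ)), ?_⟩
    rw [hm, scaledQuality_eq c m n, ← sub_le_iff_le_add', ← mul_sub]
    refine le_trans (mul_le_mul_of_nonneg_left ?_ (Nat.cast_nonneg m)) (herr m (by omega))
    have := abs_sub_abs_le_abs_sub (m * θ - round (m * (c / n : ℝ)))
      (m * (c / n : ℝ) - round (m * (c / n : ℝ)))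
    rwa [sub_sub_sub_cancel_right] at this
  · intro m hm0 hm1 r
    have h1 : (minQuality c n (M - 2) : ℝ) / n ≤ (scaledQuality c n m : ℝ) / n :=
      div_le_div_of_nonneg_right (by exact_mod_cast hall m hm0 (by omega)) hnR.le
    rw [scaledQuality_eq c m n] at h1
    have h2 := round_le (m * (c / n : ℝ)) r
    have h3 : |m * (c / n : ℝ) - r| ≤ |m * θ - r| + |m * θ - m * (c / n : ℝ)| := by
      have := abs_sub_abs_le_abs_sub (m * (c / n : ℝ) - r) (m * θ - r)
      rw [sub_sub_sub_cancel_right, abs_sub_comm (m * (c / n : ℝ)) (m * θ)] at this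
      linarith
    have h4 := mul_le_mul_of_nonneg_left (h2.trans h3) (Nat.cast_nonneg (α := ℝ) m)
    have h5 := herr m hm1.le
    rw [mul_add] at h4
    linarith

/-! ### Approximations of `π` -/

/-- Numerator and denominator of the partial products of Wallis. -/
def wallis : ℕ → ℕ × ℕ
  | 0 => (1, 1)
  | i + 1 => ((wallis i).1 * ((2 * i + 2) * (2 * i + 2)), (wallis i).2 * ((2 * i + 1) * (2 * i + 3)))

theorem primrec_wallis : Primrec wallis := by
  have h : Primrec₂ fun (i : ℕ) (w : ℕ × ℕ) =>
      (w.1 * ((2 * i + 2) * (2 * i + 2)), w.2 * ((2 * i + 1) * (2 * i + 3))) := by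
    have hi : Primrec fun y : ℕ × (ℕ × ℕ) => 2 * y.1 := Primrec.nat_double.comp Primrec.fst
    have w1 : Primrec fun y : ℕ × (ℕ × ℕ) => y.2.1 := Primrec.fst.comp Primrec.snd
    have w2 : Primrec fun y : ℕ × (ℕ × ℕ) => y.2.2 := Primrec.snd.comp Primrec.snd
    have i1 := Primrec.nat_add.comp hi (Primrec.const 1)
    have i2 := Primrec.nat_add.comp hi (Primrec.const 2)
    have i3 := Primrec.nat_add.comp hi (Primrec.const 3)
    exact Primrec.pair (Primrec.nat_mul.comp w1 (Primrec.nat_mul.comp i2 i2))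
      (Primrec.nat_mul.comp w2 (Primrec.nat_mul.comp i1 i3))
  refine (Primrec.nat_rec₁ ((1, 1) : ℕ × ℕ) h).of_eq fun m => ?_
  induction m with
  | zero => rfl
  | succ m ih => simp only [wallis, ← ih]

theorem wallis_pos (i : ℕ) : 0 < (wallis i).1 ∧ 0 < (wallis i).2 := by
  induction i with
  | zero => exact ⟨one_pos, one_pos⟩
  | succ i ih => exact ⟨mul_pos ih.1 (by positivity), mul_pos ih.2 (by positivity)⟩

theorem wallis_eq (i : ℕ) : ((wallis i).1 : ℝ) / (wallis i).2 = Real.Wallis.W i := by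
  induction i with
  | zero => simp [wallis, Real.Wallis.W]
  | succ i ih =>
    rw [Real.Wallis.W_succ, ← ih, wallis]
    have := (wallis_pos i).2
    push_cast
    field_simp

/-- The partial products W satisfy (2i+1)/(2i+2) · π/2 ≤ W ≤ π/2. Hence 1/(2W) exceeds 1/π by at
most 1/((2i+1)π), and π > 3 suffices for the bound stated. -/
theorem abs_wallis_sub_le (i : ℕ) :
    |((wallis i).2 : ℝ) / (2 * (wallis i).1) - 1 / Real.pi| ≤ 1 / (2 * i + 2) := by
  have h1 := Real.Wallis.W_le i
  have h2 := Real.Wallis.le_W i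
  rw [← wallis_eq] at h1 h2
  have hp := Real.pi_gt_three
  have hn : (0 : ℝ) < (wallis i).1 := by exact_mod_cast (wallis_pos i).1
  have hd : (0 : ℝ) < (wallis i).2 := by exact_mod_cast (wallis_pos i).2
  set a : ℝ := ((wallis i).1 : ℝ)
  set b : ℝ := ((wallis i).2 : ℝ)
  have hi : (0 : ℝ) ≤ i := Nat.cast_nonneg i
  rw [div_le_iff₀ hd] at h1
  rw [le_div_iff₀ hd, div_mul_eq_mul_div, div_mul_eq_mul_div, div_le_iff₀ (by positivity)] at h2
  have hpos : 0 ≤ b / (2 * a) - 1 / Real.pi := by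
    rw [sub_nonneg, div_le_div_iff₀ (by positivity) (by positivity)]
    linarith
  rw [abs_of_nonneg hpos, sub_le_iff_le_add, div_add_div _ _ (by positivity) (by positivity),
    div_le_div_iff₀ (by positivity) (by positivity)]
  nlinarith [mul_pos hn hd]

end RobustLRS


namespace RobustLRS

/-! ### The angle given by an input -/

/-- `x` is an input for the angle `θ`, whose absolute value is `ϑ`. -/
structure IsInputFor (x : ApproxInput) (ϑ : ℝ) : Prop where
  cos_eq : (cosOf x : ℝ) = Real.cos (2 * Real.pi * ϑ)
  sin_eq : (sinOf x : ℝ) = Real.sin (2 * Real.pi * ϑ)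
  sq_add_sq : cosOf x ^ 2 + sinOf x ^ 2 = 1
  sin_ne_zero : sinOf x ≠ 0
  pos : 0 < ϑ
  lt_half : ϑ < 1 / 2
  irrational : Irrational ϑ

/-- By Niven's theorem a rational angle would have cosine 0, ±1/2 or ±1. The values 0 and ±1 are
excluded by p, q ≠ 0, and ±1/2 would make 3 = (2q)² a rational square. -/
theorem irrational_of_cos_sin {ϑ : ℝ} {p q : ℚ} (hp : p ≠ 0) (hq : q ≠ 0)
    (h : p ^ 2 + q ^ 2 = 1) (hcos : (p : ℝ) = Real.cos (2 * Real.pi * ϑ)) : Irrational ϑ := by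
  rintro ⟨r, rfl⟩
  have hniven := niven (θ := 2 * Real.pi * r) ⟨2 * r, by push_cast; ring⟩ ⟨p, hcos.symm⟩
  rw [← hcos] at hniven
  have h3 : ¬ IsSquare ((3 : ℕ) : ℚ) := by
    rw [Rat.isSquare_natCast_iff]
    rintro ⟨a, ha⟩
    rcases Nat.lt_or_ge a 2 with h2 | h2
    · interval_cases a <;> omega
    · nlinarith
  have hcase : p = -1 ∨ p = -1 / 2 ∨ p = 0 ∨ p = 1 / 2 ∨ p = 1 := by
    simp only [Set.mem_insert_iff, Set.mem_singleton_iff] at hniven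
    have hinj : ∀ t : ℚ, (p : ℝ) = (t : ℝ) → p = t := fun t e => by exact_mod_cast e
    refine hniven.imp (fun e => hinj _ ?_) (Or.imp (fun e => hinj _ ?_) (Or.imp (fun e => hinj _ ?_)
      (Or.imp (fun e => hinj _ ?_) fun e => hinj _ ?_))) <;> · rw [e]; push_cast; rfl
  have hone : p ^ 2 ≠ 1 := fun e => hq (by
    have : q ^ 2 = 0 := by linarith
    exact pow_eq_zero_iff (two_ne_zero) |>.1 this)
  have hquarter : p ^ 2 ≠ 1 / 4 := fun e => h3 ⟨2 * q, by push_cast; linarith⟩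
  rcases hcase with rfl | rfl | rfl | rfl | rfl
  · exact hone (by norm_num)
  · exact hquarter (by norm_num)
  · exact hp rfl
  · exact hquarter (by norm_num)
  · exact hone (by norm_num)

/-- The cosine loses the sign of θ, which neither constant depends on, so |θ| is used and its sine
is nonnegative. For cos = a/d, even unreduced, d² - a² is the square of a rational number, hence of
a natural number, and the integer square root in `sinNum` is exact. -/
theorem isInputFor_abs {θ : ℝ} (hθ : θ ∈ setT) {x : ApproxInput}
    (hx : (ratOf x.1 : ℝ) = Real.cos (2 * Real.pi * θ)) : IsInputFor x |θ| := by
  obtain ⟨⟨hlo, hhi⟩, p', q', hp', hq', hpq, hz⟩ := hθ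
  have harg : 2 * (Real.pi : ℂ) * Complex.I * (θ : ℂ)
      = ((2 * Real.pi * θ : ℝ) : ℂ) * Complex.I := by push_cast; ring
  rw [harg] at hz
  have hre := congrArg Complex.re hz
  have him := congrArg Complex.im hz
  rw [Complex.exp_ofReal_mul_I_re] at hre
  rw [Complex.exp_ofReal_mul_I_im] at him
  simp at hre him
  have hD : (0 : ℚ) < den x := by exact_mod_cast den_pos x
  have hcosx : cosOf x = p' := by
    have h1 : cosOf x = ratOf x.1 := by simp [cosOf, point, den, ratOf]
    rw [h1]
    exact_mod_cast hx.trans hre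
  have hcabs : Real.cos (2 * Real.pi * |θ|) = Real.cos (2 * Real.pi * θ) := by
    rcases abs_choice θ with e | e <;> rw [e]
    rw [mul_neg, Real.cos_neg]
  -- the numerator of the sine is exact
  have hn : (x.1.1 : ℚ) = p' * den x := by
    rw [← hcosx, cosOf, point]; field_simp
  have hnat : ((x.1.1.toNat + (-x.1.1).toNat : ℕ) : ℚ) ^ 2 = (x.1.1 : ℚ) ^ 2 := by
    have e1 : ((x.1.1.toNat + (-x.1.1).toNat : ℕ) : ℤ) = |x.1.1| := by
      rcases abs_cases x.1.1 with h | h <;> omega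
    have e2 : (((x.1.1.toNat + (-x.1.1).toNat : ℕ) : ℤ) : ℚ) = |(x.1.1 : ℚ)| := by
      rw [e1, Int.cast_abs]
    rw [← sq_abs (x.1.1 : ℚ), ← e2, Int.cast_natCast]
  set a := x.1.1.toNat + (-x.1.1).toNat with ha
  have hle : a * a ≤ den x * den x := by
    have : (a : ℚ) ^ 2 ≤ (den x : ℚ) ^ 2 := by
      rw [hnat, hn]
      nlinarith [mul_nonneg (sq_nonneg q') (sq_nonneg (den x : ℚ))]
    rw [← sq, ← sq]
    exact_mod_cast this
  have hS : ((den x * den x - a * a : ℕ) : ℚ) = (q' * den x) * (q' * den x) := by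
    rw [Nat.cast_sub hle]
    push_cast
    rw [← sq (a : ℚ), hnat, hn]
    linear_combination (-(den x : ℚ) ^ 2) * hpq
  obtain ⟨t, ht⟩ := Rat.isSquare_natCast_iff.1 ⟨q' * den x, hS⟩
  have htx : sinNum x = t := by rw [sinNum, ← ha, ht, Nat.sqrt_eq]
  have hsinx : sinOf x = (t : ℚ) / den x := by simp [sinOf, point, htx]
  have hsq : sinOf x ^ 2 = q' ^ 2 := by
    rw [ht] at hS
    push_cast at hS
    rw [hsinx, div_pow, sq (t : ℚ), hS]
    field_simp
  have hsin0 : 0 ≤ sinOf x := by rw [hsinx]; positivity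
  have habs : |θ| ≤ 1 / 2 := abs_le.2 ⟨hlo.le, hhi⟩
  have hssq : Real.sin (2 * Real.pi * |θ|) ^ 2 = (q' : ℝ) ^ 2 := by
    rw [← him]
    rcases abs_choice θ with e | e <;> rw [e]
    rw [mul_neg, Real.sin_neg, neg_sq]
  have hs0 : 0 ≤ Real.sin (2 * Real.pi * |θ|) :=
    Real.sin_nonneg_of_nonneg_of_le_pi (by positivity) (by nlinarith [Real.pi_pos])
  have hsinR : (sinOf x : ℝ) = Real.sin (2 * Real.pi * |θ|) := by
    refine (sq_eq_sq₀ (by exact_mod_cast hsin0) hs0).1 ?_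
    rw [hssq]
    exact_mod_cast hsq
  have hsne : sinOf x ≠ 0 := by
    intro h0
    rw [h0] at hsq
    exact hq' (pow_eq_zero_iff two_ne_zero |>.1 (by linarith))
  have hsneR : Real.sin (2 * Real.pi * |θ|) ≠ 0 := by
    rw [← hsinR]
    exact_mod_cast hsne
  have hcosR : (cosOf x : ℝ) = Real.cos (2 * Real.pi * |θ|) := by rw [hcabs, hre, hcosx]
  refine ⟨hcosR, hsinR, by rw [hcosx, hsq, hpq], hsne, ?_, ?_, ?_⟩
  · refine abs_pos.2 ?_
    rintro rfl
    simp at hsneR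
  · refine lt_of_le_of_ne habs fun e => hsneR ?_
    rw [e, show 2 * Real.pi * (1 / 2) = Real.pi by ring, Real.sin_pi]
  · exact irrational_of_cos_sin (p := cosOf x) (by rw [hcosx]; exact hp') hsne
      (by rw [hcosx, hsq, hpq]) hcosR

theorem IsInputFor.rot_ne_one {x : ApproxInput} {ϑ : ℝ} (hx : IsInputFor x ϑ) (m : ℕ)
    (hm : 0 < m) : (rot (cosOf x) (sinOf x) m).1 ≠ 1 := by
  intro h
  have h1 := (rot_eq_cos_sin hx.cos_eq hx.sin_eq m).1
  rw [h, Rat.cast_one, eq_comm, Real.cos_eq_one_iff] at h1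
  obtain ⟨n, hn⟩ := h1
  have hm' : (m : ℝ) ≠ 0 := by positivity
  refine hx.irrational ⟨(n : ℚ) / m, ?_⟩
  push_cast
  rw [div_eq_iff hm']
  have hpi : 2 * Real.pi ≠ 0 := by positivity
  exact mul_left_cancel₀ hpi (by linarith)

/-! ### The search over the parameters -/

/-- An approximation of `1 / π`. -/
def invPi (x : ApproxInput) : ℚ :=
  ((wallis (20 * prec x)).2 : ℚ) / (2 * (wallis (20 * prec x)).1)

/-- Parameters in the search are at most 5, so this error contributes at most 1/(8 prec) to the
result. -/
theorem invPi_bounds (x : ApproxInput) : |(invPi x : ℝ) - 1 / Real.pi| ≤ 1 / (40 * prec x) := by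
  have h := abs_wallis_sub_le (20 * prec x)
  rw [invPi]
  push_cast at h ⊢
  have hk : (0 : ℝ) < prec x := by exact_mod_cast prec_pos x
  refine h.trans (one_div_le_one_div_of_le (by positivity) (by linarith))

/-- If the search over the parameters stops at `j`, then its result approximates the quality of
the approximations of the angle. -/
theorem quality_of_search {Q : RobustProperty 6}
    {B : EuclideanSpace ℝ (Fin 6) → ℝ → Set (EuclideanSpace ℝ (Fin 6))} {ℱ : Filter ℕ}
    (hQ : Detects Q B ℱ) (hℱ : Filter.atTop ≤ ℱ) {x : ApproxInput} {ϑ : ℝ} (hx : IsInputFor x ϑ)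
    {R : ℕ} (hR : 4 * prec x ≤ R)
    (hR' : 8 * invSize (cosOf x) (sinOf x) (start x) *
      (1 + 1 / growthSq (cosOf x) (sinOf x) (start x)) * (2000 * prec x ^ 2) ≤ R) {j : ℕ}
    (hlt : ∀ i < j, i < 30 * R ∧ Q (coeffs (cosOf x)) (B (centre (cosOf x) (sinOf x) (start x)
      (querySign i * ((i / 2 : ℕ) * (1 / (3 * R)))) (1 / R)) ((1 / R : ℚ) : ℝ)))
    (hj : ¬ (j < 30 * R ∧ Q (coeffs (cosOf x)) (B (centre (cosOf x) (sinOf x) (start x)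
      (querySign j * ((j / 2 : ℕ) * (1 / (3 * R)))) (1 / R)) ((1 / R : ℚ) : ℝ)))) :
    (∃ᶠ n in ℱ, ∃ r : ℤ, ((start x + n : ℕ) : ℝ) * |(start x + n : ℕ) * ϑ - r|
      ≤ (((j / 2 : ℕ) * (1 / (3 * R)) * invPi x : ℚ) : ℝ) + 1 / (2 * prec x)) ∧
    ∀ᶠ n in ℱ, ∀ r : ℤ, (((j / 2 : ℕ) * (1 / (3 * R)) * invPi x : ℚ) : ℝ) - 1 / (2 * prec x)
      ≤ ((start x + n : ℕ) : ℝ) * |(start x + n : ℕ) * ϑ - r| := by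
  have hk := prec_pos x
  have hkR : (1 : ℝ) ≤ prec x := by exact_mod_cast hk
  have hN : 0 < start x := by unfold start; positivity
  have hRpos : 0 < R := by omega
  have hRR : (0 : ℝ) < R := by exact_mod_cast hRpos
  have hRQ : (0 : ℚ) < R := by exact_mod_cast hRpos
  have hR4 : 4 * (prec x : ℝ) ≤ R := by exact_mod_cast hR
  have hpi3 := Real.pi_gt_three
  set k : ℝ := (prec x : ℝ) with hkdef
  set l := j / 2 with hl
  set η : ℚ := 1 / (3 * R) with hη
  have hη0 : 0 ≤ η := by positivity
  have hηρ : η ≤ 1 / R / 3 := by rw [hη]; apply le_of_eq; field_simp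
  have hρ0 : (0 : ℚ) < 1 / R := by positivity
  have hjle : j ≤ 30 * R := by
    by_contra hcon
    have := (hlt (30 * R) (by omega)).1
    omega
  have hηR : (η : ℝ) = 1 / (3 * R) := by rw [hη]; push_cast; rfl
  have hηk : (η : ℝ) ≤ 1 / (12 * k) := by
    rw [hηR]
    exact one_div_le_one_div_of_le (by positivity) (by linarith)
  have hb0 : (0 : ℝ) ≤ l * η := by positivity
  have hb5 : (l : ℝ) * η ≤ 5 := by
    have : (l : ℝ) ≤ 15 * R := by exact_mod_cast (by omega : l ≤ 15 * R)
    rw [hηR, mul_one_div, div_le_iff₀ (by positivity)]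
    linarith
  have hpia : |(l : ℝ) * η * invPi x - l * η / Real.pi| ≤ 1 / (8 * k) := by
    have e : (l : ℝ) * η * invPi x - l * η / Real.pi = l * η * (invPi x - 1 / Real.pi) := by ring
    rw [e, abs_mul, abs_of_nonneg hb0]
    calc (l : ℝ) * η * |(invPi x : ℝ) - 1 / Real.pi| ≤ 5 * (1 / (40 * k)) := by
          gcongr
          exact invPi_bounds x
      _ = 1 / (8 * k) := by field_simp; norm_num
  have hpia' := abs_le.1 hpia
  have hcast : (((l : ℚ) * η * invPi x : ℚ) : ℝ) = l * η * invPi x := by push_cast; rfl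
  rw [hcast]
  have hstart : ∀ n, 100 * prec x ≤ start x + n := fun n => Nat.le_add_right _ _
  have hrot : ∀ m, ((rot (cosOf x) (sinOf x) m).1 : ℝ) = Real.cos (m * (2 * Real.pi * ϑ)) ∧
      ((rot (cosOf x) (sinOf x) m).2 : ℝ) = Real.sin (m * (2 * Real.pi * ϑ)) :=
    rot_eq_cos_sin hx.cos_eq hx.sin_eq
  have hksum : 1 / (2 * k) = 1 / (8 * k) + 3 / (8 * k) := by field_simp; norm_num
  have hdivpi : ∀ {a V : ℝ}, Real.pi * V ≤ a → V ≤ a / Real.pi := fun h => by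
    rwa [le_div_iff₀ Real.pi_pos, mul_comm]
  have hk0 : k ≠ 0 := by positivity
  have h8 : 1 / (8 * k) = 1 / k / 8 := by field_simp
  have h2 : 1 / (2 * k) = 1 / k / 2 := by field_simp
  have h100 : 1 / (100 * k) = 1 / k / 100 := by field_simp
  have h15 : 15 / (100 * k) = 1 / k * 15 / 100 := by field_simp
  have h12 : 1 / (12 * k) = 1 / k / 12 := by field_simp
  have hu : 0 < 1 / k := by positivity
  rw [h8] at hpia'
  rw [h2]
  constructor
  -- Either query j failed, and its ball is infringed frequently along the filter, or the search ran
  -- to its end, where the parameter is 5. In the latter case 5/π > 1, so Dirichlet's bound is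
  -- enough.
  · by_cases hj30 : j < 30 * R
    · have hnot : ¬ Q (coeffs (cosOf x)) (B (centre (cosOf x) (sinOf x) (start x)
          (querySign j * (l * η)) (1 / R)) ((1 / R : ℚ) : ℝ)) := fun h => hj ⟨hj30, h⟩
      have hdet := (hQ (cosOf x) (sinOf x) (start x) (1 / R) η (querySign j) l hx.sq_add_sq
        hx.sin_ne_zero hx.rot_ne_one hN hρ0 hη0 hηρ (abs_querySign j).le).2
      have hfreq := Filter.not_eventually.1 (mt hdet hnot)
      refine hfreq.mono fun n hn => ?_
      have hδ : (1 / R : ℚ) * (8 * invSize (cosOf x) (sinOf x) (start x) *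
          (1 + 1 / growthSq (cosOf x) (sinOf x) (start x))) ≤ 1 / (2000 * (prec x : ℚ) ^ 2) := by
        have hkQ : (0 : ℚ) < prec x := by exact_mod_cast hk
        rw [one_div_mul_eq_div, div_le_div_iff₀ hRQ (by positivity)]
        linarith
      have hs := small_of_inner_centre_le hx.sq_add_sq hx.sin_ne_zero (start x) n hρ0.le
        (by omega) hδ (not_lt.1 hn)
      rw [(hrot _).1, (hrot _).2] at hs
      push_cast at hs
      obtain ⟨r, hr⟩ := exists_pi_mul_le (θ := ϑ) (b := l * η) (b' := querySign j * (l * η)) hk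
        (hstart n) hb5
        (by
          have h1 : |(querySign j : ℝ)| = 1 := by exact_mod_cast abs_querySign j
          rw [abs_mul, h1, one_mul, abs_of_nonneg hb0])
        (by push_cast; exact hs)
      refine ⟨r, ?_⟩
      have h3 := hdivpi hr
      rw [← hkdef, h15, add_div] at h3
      have h4 : 1 / k * 15 / 100 / Real.pi ≤ 1 / k * 15 / 100 / 3 := by gcongr
      linarith
    · have hl15 : (l : ℝ) = 15 * R := by exact_mod_cast (by omega : l = 15 * R)
      have hb : (l : ℝ) * η = 5 := by rw [hl15, hηR]; field_simp; norm_num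
      have hfreq : ∃ᶠ n in Filter.atTop, ∃ r : ℤ,
          ((start x + n : ℕ) : ℝ) * |(start x + n : ℕ) * ϑ - r| < 1 := by
        rw [Filter.frequently_atTop]
        intro M
        obtain ⟨m, hm, r, hr⟩ := Filter.frequently_atTop.1
          (frequently_mul_abs_lt_one hx.irrational) (start x + M)
        exact ⟨m - start x, by omega, r, by rw [Nat.add_sub_cancel' (by omega)]; exact hr⟩
      refine (hfreq.filter_mono hℱ).mono fun n hn => ?_
      obtain ⟨r, hr⟩ := hn
      refine ⟨r, ?_⟩
      have h5 : (5 : ℝ) / 4 ≤ 5 / Real.pi :=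
        div_le_div_of_nonneg_left (by norm_num) Real.pi_pos Real.pi_le_four
      rw [hb] at hpia' ⊢
      linarith
  -- For l = 0 the lower bound is negative. Otherwise both signs of every grid point up to l - 1
  -- have passed: the queries 2i and 2i + 1 precede j. The lost grid step is at most 1/(12 prec).
  · rcases Nat.eq_zero_or_pos l with hl0 | hlpos
    · refine Filter.Eventually.of_forall fun n r => ?_
      rw [hl0]
      have : 0 ≤ ((start x + n : ℕ) : ℝ) * |(start x + n : ℕ) * ϑ - r| := by positivity
      simp only [Nat.cast_zero, zero_mul, zero_sub]
      linarith
    · obtain ⟨l', hl'⟩ : ∃ l', l = l' + 1 := ⟨l - 1, by omega⟩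
      have e1 := (hQ (cosOf x) (sinOf x) (start x) (1 / R) η 1 l' hx.sq_add_sq
        hx.sin_ne_zero hx.rot_ne_one hN hρ0 hη0 hηρ (by simp)).1 (fun i hi => by
          have h := (hlt (2 * i) (by omega)).2
          rwa [show querySign (2 * i) = 1 by simp [querySign],
            show 2 * i / 2 = i by omega] at h)
      have e2 := (hQ (cosOf x) (sinOf x) (start x) (1 / R) η (-1) l' hx.sq_add_sq
        hx.sin_ne_zero hx.rot_ne_one hN hρ0 hη0 hηρ (by simp)).1 (fun i hi => by
          have h := (hlt (2 * i + 1) (by omega)).2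
          rwa [show querySign (2 * i + 1) = -1 by simp [querySign, Nat.add_mod],
            show (2 * i + 1) / 2 = i by omega] at h)
      filter_upwards [e1, e2] with n h3 h4 r
      rw [(hrot _).1, (hrot _).2] at h3 h4
      push_cast at h3 h4
      have hl'R : (l : ℝ) = l' + 1 := by rw [hl']; push_cast; rfl
      have hηR0 : (0 : ℝ) ≤ η := by exact_mod_cast hη0
      have h5 := le_pi_mul_of_nonneg hx.irrational hk (hstart n) (b := l' * η) (by positivity)
        (by rw [hl'R] at hb5; linarith) (by push_cast; linarith) (by push_cast; linarith) r
      rw [← hkdef, h100] at h5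
      rw [h12] at hηk
      have h6 : ((l : ℝ) * η - (1 / k / 12 + 1 / k / 100)) / Real.pi
          ≤ ((start x + n : ℕ) : ℝ) * |(start x + n : ℕ) * ϑ - r| := by
        rw [div_le_iff₀ Real.pi_pos, mul_comm _ Real.pi]
        refine le_trans ?_ h5
        rw [hl'R]
        linarith
      have h7 : (1 / k / 12 + 1 / k / 100) / Real.pi ≤ (1 / k / 12 + 1 / k / 100) / 3 := by gcongr
      rw [sub_div] at h6
      linarith

/-! ### The reductions -/

theorem Represents.unique {k : AlgCode} {x y : ℝ} (hx : Represents k x) (hy : Represents k y) :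
    x = y := by
  have := (hy x).1 ((hx x).2 rfl)
  exact_mod_cast this

/-- A code determines the recurrence and the ball, so the existential quantifiers in the decision
problem are innocuous. -/
theorem Describes.yes_iff {I : BallInput 6} {a : Fin 6 → ℚ} {c : EuclideanSpace ℝ (Fin 6)} {ρ : ℚ}
    (h : Describes I a c ρ) (Q : RobustProperty 6)
    (B : EuclideanSpace ℝ (Fin 6) → ℝ → Set (EuclideanSpace ℝ (Fin 6))) :
    (∃ a' c' ρ', Describes I a' c' ρ' ∧ Q a' (B c' (ρ' : ℝ))) ↔ Q a (B c (ρ : ℝ)) := by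
  constructor
  · rintro ⟨a', c', ρ', h', hQ⟩
    have ea : a' = a := funext fun j => (h'.1 j).symm.trans (h.1 j)
    have ec : c' = c := by
      ext j
      exact (h'.2.1 j).unique (h.2.1 j)
    have eρ : ρ' = ρ := h'.2.2.1.symm.trans h.2.2.1
    rwa [ea, ec, eρ] at hQ
  · exact fun hQ => ⟨a, c, ρ, h, hQ⟩

/-- The decision problem for a robust property and a family of balls. -/
def ballProblem (Q : RobustProperty 6)
    (B : EuclideanSpace ℝ (Fin 6) → ℝ → Set (EuclideanSpace ℝ (Fin 6))) :
    DecisionProblem (BallInput 6) where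
  valid I := ∃ a c ρ, Describes I a c ρ
  yes I := ∃ a c ρ, Describes I a c ρ ∧ Q a (B c (ρ : ℝ))

theorem primrecRat_invPi : PrimrecRat invPi := by
  have h := primrec_wallis.comp (Primrec.nat_mul.comp (Primrec.const 20) primrec_prec)
  exact (PrimrecRat.natCast (Primrec.snd.comp h)).div
    ((PrimrecRat.const 2).mul (PrimrecRat.natCast (Primrec.fst.comp h)))

/-- With an oracle, the quality of all but finitely many approximations can be computed. -/
theorem exists_computableIn_quality {Q : RobustProperty 6}
    {B : EuclideanSpace ℝ (Fin 6) → ℝ → Set (EuclideanSpace ℝ (Fin 6))} {ℱ : Filter ℕ}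
    (hQ : Detects Q B ℱ) (hℱ : Filter.atTop ≤ ℱ) {O : BallInput 6 → Bool}
    (hO : Solves O (ballProblem Q B)) {g : ApproxInput × ℚ → ℚ}
    (hg : ∀ {t : ApproxInput × ℕ → ℚ}, PrimrecRat t → PrimrecRat fun y => g (y.1, t y)) :
    ∃ f : ApproxInput → RatCode, ComputableIn {toOracle O} f ∧
      ∀ x ϑ, IsInputFor x ϑ → ∃ t : ℚ, ratOf (f x) = g (x, t) ∧
        (∃ᶠ n in ℱ, ∃ r : ℤ, ((start x + n : ℕ) : ℝ) * |(start x + n : ℕ) * ϑ - r|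
          ≤ (t : ℝ) + 1 / (2 * prec x)) ∧
        ∀ᶠ n in ℱ, ∀ r : ℤ, (t : ℝ) - 1 / (2 * prec x)
          ≤ ((start x + n : ℕ) : ℝ) * |(start x + n : ℕ) * ϑ - r| := by
  obtain ⟨R, hR, hRspec⟩ := exists_radius
  obtain ⟨q, hq, hqspec⟩ := exists_query hR
  have ht : PrimrecRat fun y : ApproxInput × ℕ =>
      (y.2 / 2 : ℕ) * (1 / (3 * (R y.1 : ℚ))) * invPi y.1 :=
    ((PrimrecRat.natCast (Primrec.nat_div.comp Primrec.snd (Primrec.const 2))).mul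
      ((PrimrecRat.const 1).div ((PrimrecRat.const 3).mul
        (primrecRat_comp_fst (PrimrecRat.natCast hR))))).mul (primrecRat_comp_fst primrecRat_invPi)
  obtain ⟨post, hpost, hpost'⟩ := hg ht
  obtain ⟨f, hf, hfspec⟩ := exists_computableIn_search hq
    (Primrec.nat_mul.comp (Primrec.const 30) hR) hpost O
  refine ⟨f, hf, fun x ϑ hx => ?_⟩
  obtain ⟨j, hfj, hlt, hj⟩ := hfspec x
  refine ⟨_, by rw [hfj, hpost'], ?_⟩
  have hRx : 0 < R x := by
    have := (hRspec x).1
    have := prec_pos x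
    omega
  have hans : ∀ i, O (q (x, i)) = true ↔ Q (coeffs (cosOf x)) (B (centre (cosOf x) (sinOf x)
      (start x) (querySign i * ((i / 2 : ℕ) * (1 / (3 * R x)))) (1 / R x)) ((1 / R x : ℚ) : ℝ)) :=
    fun i => (hO _ ⟨_, _, _, hqspec x i hRx hx.sq_add_sq hx.sin_ne_zero⟩).trans
      ((hqspec x i hRx hx.sq_add_sq hx.sin_ne_zero).yes_iff Q B)
  simp only [hans] at hlt hj
  exact quality_of_search hQ hℱ hx (hRspec x).1 (hRspec x).2 hlt hj

/-- A positive rational number has numerator at least 1, hence is at least 1/`prec`. -/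
theorem one_div_two_mul_prec_lt {x : ApproxInput} (hε : 0 < ratOf x.2) :
    (1 : ℝ) / (2 * prec x) < (ratOf x.2 : ℝ) := by
  have hk : (0 : ℝ) < prec x := by exact_mod_cast prec_pos x
  have h1 : (0 : ℚ) < (x.2.1 : ℚ) := by
    rw [ratOf] at hε
    exact (div_pos_iff_of_pos_right (by positivity)).1 hε
  have h2 : (1 : ℝ) ≤ x.2.1 := by
    have : (0 : ℤ) < x.2.1 := by exact_mod_cast h1
    exact_mod_cast this
  have h3 : (ratOf x.2 : ℝ) = x.2.1 / prec x := by
    rw [ratOf, prec]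
    push_cast
    rfl
  rw [h3, div_lt_div_iff₀ (by positivity) hk]
  nlinarith

/-- Discarding the indices below `start` does not affect statements about infinitely many or almost
all m. -/
theorem tLagrangeHard_ballProblem {Q : RobustProperty 6}
    {B : EuclideanSpace ℝ (Fin 6) → ℝ → Set (EuclideanSpace ℝ (Fin 6))}
    (hQ : Detects Q B Filter.atTop) : TLagrangeHard (ballProblem Q B) := by
  intro O hO
  obtain ⟨f, hf, hspec⟩ := exists_computableIn_quality hQ le_rfl hO (g := Prod.snd) fun ht => ht
  refine ⟨f, hf, fun θ hθ p e hp he => ?_⟩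
  obtain ⟨t, hft, h1, h2⟩ := hspec (p, e) |θ| (isInputFor_abs hθ hp)
  rw [hft]
  refine lt_of_le_of_lt (abs_sub_lagrangeConstant_le ?_ ?_)
    (one_div_two_mul_prec_lt (x := (p, e)) he)
  · rw [Filter.frequently_atTop] at h1 ⊢
    intro M
    obtain ⟨n, hn, hr⟩ := h1 M
    exact ⟨start (p, e) + n, by omega, hr⟩
  · rw [Filter.eventually_atTop] at h2 ⊢
    obtain ⟨M, hM⟩ := h2
    refine ⟨start (p, e) + M, fun m hm r => ?_⟩
    have := hM (m - start (p, e)) (by omega) r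
    rwa [Nat.add_sub_cancel' (by omega)] at this

/-- The number of steps in the approximation of the angle. -/
def angleSteps (x : ApproxInput) : ℕ := 5 * (start x * start x) * prec x

/-- The quality of the first approximations of the angle. -/
def initialQuality (x : ApproxInput) : ℚ :=
  (minQuality (halfTurns (point x) (angleSteps x)) (2 * angleSteps x) (start x - 2) : ℚ) /
    (2 * angleSteps x : ℕ)

theorem primrecRat_initialQuality : PrimrecRat initialQuality := by
  have hK : Primrec angleSteps := Primrec.nat_mul.comp (Primrec.nat_mul.comp (Primrec.const 5)
    (Primrec.nat_mul.comp primrec_start primrec_start)) primrec_prec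
  have h2K := Primrec.nat_double.comp hK
  exact (PrimrecRat.natCast (primrec_minQuality.comp (Primrec.pair
    (Primrec.pair (primrec_halfTurns.comp primrec_point hK) h2K)
    (Primrec.nat_sub.comp primrec_start (Primrec.const 2))))).div (PrimrecRat.natCast h2K)

theorem initialQuality_bounds {x : ApproxInput} {ϑ : ℝ} (hx : IsInputFor x ϑ) :
    (∃ m : ℕ, 0 < m ∧ ∃ r : ℤ,
      (m : ℝ) * |m * ϑ - r| ≤ (initialQuality x : ℝ) + 1 / (2 * prec x)) ∧
    ∀ m : ℕ, 0 < m → m < start x → ∀ r : ℤ,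
      (initialQuality x : ℝ) - 1 / (2 * prec x) ≤ (m : ℝ) * |m * ϑ - r| := by
  have hk := prec_pos x
  have hN : 100 ≤ start x := by unfold start; omega
  have hK : 0 < angleSteps x := by unfold angleSteps; positivity
  have hkR : (0 : ℝ) < prec x := by exact_mod_cast hk
  have hNR : (0 : ℝ) < start x := by exact_mod_cast (by omega : 0 < start x)
  have hKR : (0 : ℝ) < angleSteps x := by exact_mod_cast hK
  have hturn := halfTurns_le (z := point x) (den_pos x) hx.pos hx.lt_half hx.cos_eq hx.sin_eq
    (angleSteps x)
  have h := minQuality_bounds (θ := ϑ) (τ := 1 / (2 * prec x))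
    (c := halfTurns (point x) (angleSteps x)) (n := 2 * angleSteps x) (M := start x)
    (by positivity) ?_ ?_ (by omega)
  · have e : (initialQuality x : ℝ) =
        (minQuality (halfTurns (point x) (angleSteps x)) (2 * angleSteps x) (start x - 2) : ℝ) /
          ((2 * angleSteps x : ℕ) : ℝ) := by
      rw [initialQuality, Rat.cast_div, Rat.cast_natCast, Rat.cast_natCast]
    rw [e]
    exact h
  · push_cast
    have e : ϑ - (halfTurns (point x) (angleSteps x) : ℝ) / (2 * angleSteps x)
        = (2 * angleSteps x * ϑ - halfTurns (point x) (angleSteps x)) / (2 * angleSteps x) := by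
      field_simp
    rw [e, abs_div, abs_of_nonneg (by linarith), abs_of_pos (by positivity)]
    exact div_le_div_of_nonneg_right (by linarith) (by positivity)
  -- The choice of `angleSteps` makes the error `start`²/(2 · `angleSteps`) equal to 1/(10 `prec`).
  · rw [div_le_div_iff₀ (by positivity) (by positivity)]
    have : (angleSteps x : ℝ) = 5 * (start x * start x) * prec x := by
      rw [angleSteps]; push_cast; rfl
    push_cast
    rw [this]
    have hpos : 0 < (start x : ℝ) * start x * prec x := by positivity
    nlinarith

/-- The oracle controls only m ≥ `start`. The smaller m are handled by `initialQuality`, and the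
minimum of the two values approximates the infimum over all m. -/
theorem tDiophantineHard_ballProblem {Q : RobustProperty 6}
    {B : EuclideanSpace ℝ (Fin 6) → ℝ → Set (EuclideanSpace ℝ (Fin 6))}
    (hQ : Detects Q B ⊤) : TDiophantineHard (ballProblem Q B) := by
  intro O hO
  obtain ⟨f, hf, hspec⟩ := exists_computableIn_quality hQ le_top hO
    (g := fun y => min y.2 (initialQuality y.1)) fun ht =>
      ht.min (primrecRat_comp_fst primrecRat_initialQuality)
  refine ⟨f, hf, fun θ hθ p e hp he => ?_⟩
  have hx := isInputFor_abs (x := (p, e)) hθ hp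
  obtain ⟨t, hft, h1, h2⟩ := hspec (p, e) |θ| hx
  obtain ⟨h3, h4⟩ := initialQuality_bounds hx
  rw [hft]
  have hmin : ((min t (initialQuality (p, e)) : ℚ) : ℝ) = min (t : ℝ) (initialQuality (p, e)) :=
    Rat.cast_min _ _
  simp only [hmin]
  refine lt_of_le_of_lt (abs_sub_diophantineType_le ?_ ?_)
    (one_div_two_mul_prec_lt (x := (p, e)) he)
  · rcases min_choice (t : ℝ) (initialQuality (p, e)) with h | h
    · rw [h]
      obtain ⟨n, r, hr⟩ := h1.exists
      have : 0 < start (p, e) := by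
        have := prec_pos (p, e)
        unfold start
        omega
      exact ⟨start (p, e) + n, by omega, r, hr⟩
    · rw [h]
      exact h3
  · intro m hm r
    rcases Nat.lt_or_ge m (start (p, e)) with h | h
    · have := h4 m hm h r
      have := min_le_right (t : ℝ) (initialQuality (p, e))
      linarith
    · have h5 := Filter.eventually_top.1 h2 (m - start (p, e)) r
      rw [Nat.add_sub_cancel' h] at h5
      have := min_le_left (t : ℝ) (initialQuality (p, e))
      linarith

end RobustLRS

theorem theorem2 :
    (RobustLRS.TDiophantineHard (RobustLRS.openBallProblem (RobustLRS.RobustPositivity 6)) ∧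
      RobustLRS.TDiophantineHard (RobustLRS.closedBallProblem (RobustLRS.RobustPositivity 6))) ∧
    (RobustLRS.TDiophantineHard (RobustLRS.openBallProblem (RobustLRS.RobustSkolem 6)) ∧
      RobustLRS.TDiophantineHard (RobustLRS.closedBallProblem (RobustLRS.RobustSkolem 6))) ∧
    (RobustLRS.TLagrangeHard
        (RobustLRS.openBallProblem (RobustLRS.RobustUniformUltimatePositivity 6)) ∧
      RobustLRS.TLagrangeHard
        (RobustLRS.closedBallProblem (RobustLRS.RobustUniformUltimatePositivity 6))) ∧
    RobustLRS.TLagrangeHard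
      (RobustLRS.closedBallProblem (RobustLRS.RobustNonUniformUltimatePositivity 6)) := by
  have hopen : ∀ (c : EuclideanSpace ℝ (Fin 6)) (r : ℝ), Metric.ball c r ⊆ Metric.ball c r ∧
      Metric.ball c r ⊆ Metric.closedBall c r :=
    fun _ _ => ⟨subset_rfl, Metric.ball_subset_closedBall⟩
  have hclosed : ∀ (c : EuclideanSpace ℝ (Fin 6)) (r : ℝ), Metric.ball c r ⊆ Metric.closedBall c r ∧
      Metric.closedBall c r ⊆ Metric.closedBall c r :=
    fun _ _ => ⟨Metric.ball_subset_closedBall, subset_rfl⟩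
  exact ⟨⟨RobustLRS.tDiophantineHard_ballProblem (RobustLRS.detects_robustPositivity hopen),
      RobustLRS.tDiophantineHard_ballProblem (RobustLRS.detects_robustPositivity hclosed)⟩,
    ⟨RobustLRS.tDiophantineHard_ballProblem (RobustLRS.detects_robustSkolem hopen),
      RobustLRS.tDiophantineHard_ballProblem (RobustLRS.detects_robustSkolem hclosed)⟩,
    ⟨RobustLRS.tLagrangeHard_ballProblem
        (RobustLRS.detects_robustUniformUltimatePositivity hopen),
      RobustLRS.tLagrangeHard_ballProblem
        (RobustLRS.detects_robustUniformUltimatePositivity hclosed)⟩,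
    RobustLRS.tLagrangeHard_ballProblem RobustLRS.detects_robustNonUniformUltimatePositivity⟩
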